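/- **Theorem 2.1.** Let $T>0$, let $\lambda\in C^{1,1}([0,1]\times[0,1])$ be nonnegative (continuous first partial derivatives up to the boundary) and let $\phi\in C[0,1]$ be nonnegative. For $N\ge1$ let $\{X^N_t\}_{t\ge0}$ be the càdlàg Markov process on $\{0,1,2,\dots\}^N$ with generator $$\mathcal L_Nf(x)=\sum_{i=1}^N\sum_{j=1}^N\frac{x(i)\,\lambda(\frac iN,\frac jN)}{N}\big(f(x^{i,j})-f(x)\big),$$ where $x^{i,i}=x$ and, for $i\neq j$, $x^{i,j}$ is obtained from $x$ by moving one ball from box $i$ to box $j$. That the process has generator $\mathcal L_N$ means that $f(X^N_t)-\int_0^t\mathcal L_Nf(X^N_s)\,ds$ is a martingale for the natural filtration of $X^N$, for every finitely supported $f$. Let $\mathcal S=C[0,1]'$ carry the topology of pointwise convergence on $C[0,1]$, let $D([0,T],\mathcal S)$ be the space of càdlàg functions $[0,T]\to\mathcal S$ with the Skorokhod ($J_1$) topology, and let $$\mu^N_t=\frac1N\sum_{i=1}^NX^N_t(i)\,\delta_{i/N},\qquad 0\le t\le T.$$ For $f\in C[0,1]$ put $(P_1f)(x)=\int_0^1\lambda(x,y)f(y)\,dy$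 and $(P_2f)(x)=f(x)\int_0^1\lambda(x,y)\,dy$. A weak solution of $$\frac{d}{dt}\mu_t=(P_1^*-P_2^*)\mu_t\quad(0\le t\le T),\qquad \mu_0(dx)=\phi(x)\,dx,$$ is an element $\mu\in D([0,T],\mathcal S)$ such that, for all $0\le t\le T$ and $f\in C[0,1]$, $$\mu_t(f)=\int_0^1f(x)\phi(x)\,dx+\int_0^t\mu_s\big((P_1-P_2)f\big)\,ds .$$ Then this equation has exactly one weak solution $\mu\in D([0,T],\mathcal S)$. Moreover $\mu_t(dx)=\rho(t,x)\,dx$ for all $0\le t\le T$, where $\rho$ is continuous on $[0,T]\times[0,1]$ and satisfies, for all $0\le t\le T$ and $x\in[0,1]$ (with one-sided derivatives at $t=0$ and $t=T$), $$\partial_t\rho(t,x)=\int_0^1\lambda(y,x)\rho(t,y)\,dy-\rho(t,x)\int_0^1\lambda(x,y)\,dy,\qquad \rho(0,x)=\phi(x).$$ Finally, assume (Assumption (A)) that for every $N\ge1$ the variables $X^N_0(1),\dots,X^N_0(N)$ are independent and $X^N_0(i)$ is Poisson distributed with mean $\phi(i/N)$. Then the random elements $\mu^N=\{\mu^N_t\}_{0\le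 t\le T}$ of $D([0,T],\mathcal S)$ converge weakly, as $N\to\infty$, to the deterministic element $\mu$. -/

import Mathlib

open Set Filter Topology MeasureTheory ProbabilityTheory unitInterval
open scoped NNReal

noncomputable section

namespace Ehrenfest

/-! ### The space of càdlàg paths with values in the dual of `C[0,1]` -/

/-- `𝒮`: the dual of `C[0,1]` with the topology of pointwise convergence on `C[0,1]`. -/
abbrev DualC : Type := WeakDual ℝ C(I, ℝ)

/-- Right-continuous with left limits. (At a last point of the time set the first condition is
void, and at a first point the second one is.) -/
def IsCadlag {ι E : Type*} [TopologicalSpace ι] [Preorder ι] [TopologicalSpace E]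
    (F : ι → E) : Prop :=
  ∀ t, ContinuousWithinAt F (Ioi t) t ∧ ∃ l, Tendsto F (𝓝[<] t) (𝓝 l)

/-- `D([0,T], 𝒮)`. -/
@[ext]
structure SkorokhodSpace (T : ℝ) where
  toFun : Icc (0 : ℝ) T → DualC
  cadlag : IsCadlag toFun

namespace SkorokhodSpace

variable {T : ℝ}

instance : CoeFun (SkorokhodSpace T) (fun _ => Icc (0 : ℝ) T → DualC) := ⟨toFun⟩

/-- The basic neighbourhood of `F` given by a finite set `A` of test functions and `ε`: paths which,
after an increasing bijective change of time that moves every time by less than `ε`, are uniformly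
in time `ε`-close to `F` when tested against the elements of `A`. -/
def nbhd (F : SkorokhodSpace T) (A : Finset C(I, ℝ)) (ε : ℝ) : Set (SkorokhodSpace T) :=
  {G | ∃ τ : Icc (0 : ℝ) T ≃o Icc (0 : ℝ) T,
    (∀ t, |(τ t : ℝ) - t| < ε) ∧ ∀ f ∈ A, ∀ t, |G (τ t) f - F t f| < ε}

lemma nbhd_mono (F : SkorokhodSpace T) {A B : Finset C(I, ℝ)} {ε δ : ℝ}
    (hAB : A ⊆ B) (h : δ ≤ ε) : nbhd F B δ ⊆ nbhd F A ε := by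
  rintro G ⟨τ, h1, h2⟩
  exact ⟨τ, fun t => (h1 t).trans_le h, fun f hf t => (h2 f (hAB hf) t).trans_le h⟩

/-- The Skorokhod (J1) topology. -/
instance : TopologicalSpace (SkorokhodSpace T) where
  IsOpen U := ∀ F ∈ U, ∃ (A : Finset C(I, ℝ)) (ε : ℝ), 0 < ε ∧ nbhd F A ε ⊆ U
  isOpen_univ := fun _ _ => ⟨∅, 1, one_pos, subset_univ _⟩
  isOpen_inter := by
    classical
    intro U V hU hV F hF
    obtain ⟨A, ε, hε, hA⟩ := hU F hF.1
    obtain ⟨B, δ, hδ, hB⟩ := hV F hF.2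
    exact ⟨A ∪ B, min ε δ, lt_min hε hδ, subset_inter
      ((nbhd_mono F Finset.subset_union_left (min_le_left _ _)).trans hA)
      ((nbhd_mono F Finset.subset_union_right (min_le_right _ _)).trans hB)⟩
  isOpen_sUnion := by
    intro s hs F hF
    obtain ⟨U, hU, hFU⟩ := hF
    obtain ⟨A, ε, hε, hA⟩ := hs U hU F hFU
    exact ⟨A, ε, hε, hA.trans (subset_sUnion_of_mem hU)⟩

instance : MeasurableSpace (SkorokhodSpace T) := borel _

instance : BorelSpace (SkorokhodSpace T) := ⟨rfl⟩

end SkorokhodSpace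

/-! ### The `N`-urn model -/

/-- A configuration gives the number of balls in each of the `N` boxes. The box called `i + 1` in
the usual numbering `1, …, N` is the element `i` of `Fin N`. -/
abbrev Config (N : ℕ) : Type := Fin N → ℕ

/-- The location of a box: the boxes `1, …, N` are placed at `1/N, 2/N, …, N/N`. -/
def loc {N : ℕ} (i : Fin N) : I :=
  ⟨((i : ℝ) + 1) / N, by positivity, by
    have h : ((i : ℝ) + 1) ≤ N := by exact_mod_cast i.isLt
    exact div_le_one_of_le₀ h (by positivity)⟩

/-- The configuration `x^{i,j}` after a ball of box `i` is put into box `j`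
(only used when box `i` is not empty). -/
def move {N : ℕ} (x : Config N) (i j : Fin N) : Config N := fun l =>
  if i = j then x l else if l = i then x i - 1 else if l = j then x j + 1 else x l

/-- The generator `ℒ_N`. -/
def generator (lam : C(I × I, ℝ)) (N : ℕ) (f : Config N → ℝ) (x : Config N) : ℝ :=
  ∑ i, ∑ j, (x i : ℝ) * lam (loc i, loc j) / N * (f (move x i j) - f x)

/-- `X` is the Markov process on `{0,1,2,…}^N` with generator `ℒ_N`: it has càdlàg paths for the
discrete topology of the configurations, and it solves the martingale problem for `ℒ_N` on the
finitely supported functions, with respect to its natural filtration. (The total number of balls is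
conserved, so that this is a martingale problem on finite sets of configurations.) -/
structure IsUrnProcess (lam : C(I × I, ℝ)) (N : ℕ) {Ω : Type*} [MeasurableSpace Ω]
    (P : Measure Ω) (X : ℝ≥0 → Ω → Config N) : Prop where
  measurable : ∀ t, Measurable (X t)
  cadlag : ∀ ω, IsCadlag (fun t => X t ω)
  martingale : ∀ f : Config N → ℝ, f.support.Finite →
    Martingale
      (fun (t : ℝ≥0) ω => f (X t ω) - ∫ s in (0 : ℝ)..t, generator lam N f (X s.toNNReal ω))
      (Filtration.natural X (fun t => (measurable t).stronglyMeasurable)) P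

/-- Assumption (A) for one `N`: the initial numbers of balls are independent, that of box `i` being
Poisson with mean `φ(i/N)`. -/
def PoissonInitial (φ : C(I, ℝ)) (N : ℕ) {Ω : Type*} [MeasurableSpace Ω]
    (P : Measure Ω) (X : ℝ≥0 → Ω → Config N) : Prop :=
  iIndepFun (fun (i : Fin N) ω => X 0 ω i) P ∧
    ∀ i : Fin N, HasLaw (fun ω => X 0 ω i) (poissonMeasure (φ (loc i)).toNNReal) P

/-- `(1/N) ∑ x(i) δ_{i/N}` as an element of `𝒮`. -/
def empirical {N : ℕ} (x : Config N) : DualC :=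
  StrongDual.toWeakDual ((1 / N : ℝ) • ∑ i, (x i : ℝ) • ContinuousMap.evalCLM ℝ (loc i))

lemma empirical_apply {N : ℕ} (x : Config N) (f : C(I, ℝ)) :
    empirical x f = (1 / N : ℝ) * ∑ i, (x i : ℝ) * f (loc i) := by
  change ((1 / N : ℝ) • ∑ i, (x i : ℝ) • ContinuousMap.evalCLM ℝ (loc i) : C(I, ℝ) →L[ℝ] ℝ) f = _
  simp

/-- The path `(μ^N_t)_{0 ≤ t ≤ T}` of empirical measures of a path of configurations. -/
def empiricalPath (T : ℝ) {N : ℕ} (x : ℝ≥0 → Config N) (hx : IsCadlag x) : SkorokhodSpace T where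
  toFun t := empirical (x ⟨t, t.2.1⟩)
  cadlag := by
    have hc : Continuous (empirical (N := N)) := continuous_of_discreteTopology
    have hi : Continuous (fun t : Icc (0 : ℝ) T => (⟨t, t.2.1⟩ : ℝ≥0)) := by fun_prop
    intro t
    obtain ⟨h1, l, h2⟩ := hx ⟨t, t.2.1⟩
    refine ⟨?_, empirical l, ?_⟩
    · exact hc.continuousAt.comp_continuousWithinAt
        (h1.comp hi.continuousWithinAt (fun s (hs : t < s) => hs))
    · exact (hc.tendsto l).comp (h2.comp 
        (hi.continuousWithinAt.tendsto_nhdsWithin (fun s (hs : s < t) => hs)))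

/-! ### The limit equation -/

/-- `(P₁ f)(x) = ∫₀¹ λ(x,y) f(y) dy`. -/
def P₁ (lam : C(I × I, ℝ)) (f : C(I, ℝ)) : C(I, ℝ) where
  toFun x := ∫ y : I, lam (x, y) * f y
  continuous_toFun := by
    have h := continuous_parametric_integral_of_continuous (μ := (volume : Measure I))
      (f := fun x y => lam (x, y) * f y) (by fun_prop) isCompact_univ
    simpa using h

/-- `(P₂ f)(x) = f(x) ∫₀¹ λ(x,y) dy`. -/
def P₂ (lam : C(I × I, ℝ)) (f : C(I, ℝ)) : C(I, ℝ) where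
  toFun x := f x * ∫ y : I, lam (x, y)
  continuous_toFun := by
    have h := continuous_parametric_integral_of_continuous (μ := (volume : Measure I))
      (f := fun x y => lam (x, y)) (by fun_prop) isCompact_univ
    exact f.continuous.mul (by simpa using h)

/-- `μ` is a weak solution of `dμ_t/dt = (P₁* - P₂*) μ_t`, `μ_0(dx) = φ(x) dx`, on `[0,T]`: for all
`t` and `f`, `μ_t(f) = ∫ f φ dx + ∫₀ᵗ μ_s((P₁ - P₂) f) ds`. (The projection onto `[0,T]` is the
identity for the times `s` that occur.) -/
def IsWeakSolution (lam : C(I × I, ℝ)) (φ : C(I, ℝ)) {T : ℝ} (hT : 0 < T)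
    (μ : SkorokhodSpace T) : Prop :=
  ∀ (t : Icc (0 : ℝ) T) (f : C(I, ℝ)),
    μ t f = (∫ x : I, f x * φ x) +
      ∫ s in (0 : ℝ)..t, μ (projIcc 0 T hT.le s) (P₁ lam f - P₂ lam f)

/-- `ρ` is continuous on `[0,T] × [0,1]` and solves there
`∂ρ/∂t (t,x) = ∫₀¹ λ(y,x) ρ(t,y) dy - ρ(t,x) ∫₀¹ λ(x,y) dy`, `ρ(0,x) = φ(x)`
(one-sided derivatives at `t = 0` and `t = T`). -/
structure SolvesDensityEquation (lam : C(I × I, ℝ)) (φ : C(I, ℝ)) (T : ℝ)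
    (ρ : ℝ → I → ℝ) : Prop where
  continuousOn : ContinuousOn (fun p : ℝ × I => ρ p.1 p.2) (Icc 0 T ×ˢ univ)
  initial : ∀ x, ρ 0 x = φ x
  hasDeriv : ∀ t ∈ Icc 0 T, ∀ x, HasDerivWithinAt (fun s => ρ s x)
    ((∫ y : I, lam (y, x) * ρ t y) - ρ t x * ∫ y : I, lam (x, y)) (Icc 0 T) t

/-- `λ ∈ C^{1,1}([0,1] × [0,1])`: continuously differentiable up to the boundary of the square.
(The projections are the identity on the square.) -/
def IsC1 (lam : C(I × I, ℝ)) : Prop :=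
  ContDiffOn ℝ 1 (fun p : ℝ × ℝ => lam (projIcc 0 1 zero_le_one p.1, projIcc 0 1 zero_le_one p.2))
    (Icc 0 1 ×ˢ Icc 0 1)

end Ehrenfest

/-!
The limit is deterministic, so no tightness argument is needed. By definition of the Skorokhod
topology, every neighbourhood of a path `μ` contains the paths that are uniformly in time close to
`μ` when tested against finitely many functions; weak convergence to `μ` therefore follows from
`sup_t |μ^N_t(f) - μ_t(f)| → 0` in probability for each single `f`
(`SkorokhodSpace.tendstoInDistribution_of_uniform`).

Write `Q = P₁ - P₂`, a bounded operator on `C[0,1]`. If functionals `D_t`, bounded by `C`, satisfy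
`D_t(g) = ∫₀ᵗ D_s(Q g) ds` up to an error `ε` for `g = f, Q f, …, Q^(n-1) f`, then iterating the
equation bounds `D_t(f)` by a multiple of `ε` plus a remainder that tends to zero with `n`
(`abs_le_of_approx_solution`). With `ε = 0` this is the uniqueness of the weak solution. Existence
is explicit: the density is `exp (t Q*) φ`, where `Q*` acts on densities as a bounded operator of
`C[0,1]`, and the weak form follows by duality.

For the empirical measures, `D_t = μ^N_t - μ_t` satisfies the equation up to three errors: the
initial value (Chebyshev's inequality for independent Poisson variables), the replacement of `Q` by
its discretization (a Riemann sum that converges uniformly), and a martingale. Since the martingale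
problem is only posed for finitely supported functions, test functions are truncated to
configurations of at most `K` balls; moves conserve the number of balls, so truncation commutes
with the generator. The second moment of the martingale is bounded by the carré du champ, which is
of order `1 / N` (`IsUrnProcess.integral_sq_dynkin_sub_le`), and Doob's inequality makes this
uniform in time. The conservation of balls along the path is the same estimate for a function with
vanishing carré du champ.

Convergence in distribution includes the measurability of `ω ↦ μ^N` for the Borel `σ`-algebra of the
Skorokhod topology, which is not metrizable here. It holds because the configurations form a
countable discrete space: a step path is close in the `J₁` sense to its samples along a fine grid,
each of which takes countably many values (`SkorokhodSpace.measurable_of_step`).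
-/

namespace Ehrenfest

/-! ### Càdlàg functions -/

lemma IsCadlag.comp_continuous {ι E E' : Type*} [TopologicalSpace ι] [Preorder ι]
    [TopologicalSpace E] [TopologicalSpace E'] {F : ι → E} (hF : IsCadlag F) {g : E → E'}
    (hg : Continuous g) : IsCadlag (fun t => g (F t)) := fun t =>
  ⟨hg.continuousAt.comp_continuousWithinAt (hF t).1,
    let ⟨l, hl⟩ := (hF t).2; ⟨g l, (hg.tendsto l).comp hl⟩⟩

lemma IsCadlag.comp_strictMono {ι κ E : Type*} [TopologicalSpace ι] [Preorder ι]
    [TopologicalSpace κ] [Preorder κ] [TopologicalSpace E] {F : κ → E} (hF : IsCadlag F)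
    {e : ι → κ} (he : Continuous e) (hmono : StrictMono e) : IsCadlag (fun t => F (e t)) :=
  fun t => ⟨(hF (e t)).1.comp he.continuousWithinAt fun _ hs => hmono hs,
    let ⟨l, hl⟩ := (hF (e t)).2
    ⟨l, hl.comp (he.continuousWithinAt.tendsto_nhdsWithin fun _ hs => hmono hs)⟩⟩

lemma isCadlag_of_continuous {ι E : Type*} [TopologicalSpace ι] [Preorder ι]
    [TopologicalSpace E] {F : ι → E} (hF : Continuous F) : IsCadlag F := fun t =>
  ⟨hF.continuousWithinAt, F t, hF.continuousAt.tendsto.mono_left inf_le_left⟩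

/-- Right-continuity is preserved by a continuous nondecreasing change of the time set. -/
lemma IsCadlag.rightContinuous_comp {ι E : Type*} [TopologicalSpace ι] [PartialOrder ι]
    [TopologicalSpace E] {F : ι → E} (hF : IsCadlag F) {e : ℝ → ι} (he : Continuous e)
    (hmono : Monotone e) (t : ℝ) :
    ContinuousWithinAt (fun s => F (e s)) (Ioi t) t := by
  have h : ContinuousWithinAt F (Ici (e t)) (e t) := continuousWithinAt_Ioi_iff_Ici.1 (hF (e t)).1
  exact h.comp he.continuousWithinAt fun s (hs : t < s) => hmono hs.le

lemma IsCadlag.exists_abs_le {ι : Type*} [TopologicalSpace ι] [LinearOrder ι] [CompactSpace ι]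
    {F : ι → ℝ} (hF : IsCadlag F) : ∃ C, ∀ t, |F t| ≤ C := by
  have key : ∀ t : ι, ∃ C, ∀ᶠ s in 𝓝 t, |F s| ≤ C := by
    intro t
    obtain ⟨h1, l, h2⟩ := hF t
    have h1' : ∀ᶠ s in 𝓝[>] t, |F s| < |F t| + 1 :=
      h1.abs.eventually (gt_mem_nhds (lt_add_one _))
    have h2' : ∀ᶠ s in 𝓝[<] t, |F s| < |l| + 1 := h2.abs.eventually (gt_mem_nhds (lt_add_one _))
    refine ⟨max (|F t| + 1) (|l| + 1), ?_⟩
    rw [eventually_nhdsWithin_iff] at h1' h2'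
    filter_upwards [h1', h2'] with s hs1 hs2
    rcases lt_trichotomy s t with h | h | h
    · exact (hs2 h).le.trans (le_max_right _ _)
    · subst h
      exact (lt_add_one _).le.trans (le_max_left _ _)
    · exact (hs1 h).le.trans (le_max_left _ _)
  have := isCompact_univ (X := ι).induction_on (p := fun s => ∃ C, ∀ t ∈ s, |F t| ≤ C)
    ⟨0, by simp⟩ (fun s u hsu ⟨C, hC⟩ => ⟨C, fun t ht => hC t (hsu ht)⟩)
    (fun s u ⟨C, hC⟩ ⟨C', hC'⟩ => ⟨max C C', fun t ht => ht.elim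
      (fun h => (hC t h).trans (le_max_left _ _)) (fun h => (hC' t h).trans (le_max_right _ _))⟩)
    (fun t _ => by
      obtain ⟨C, hC⟩ := key t
      exact ⟨_, mem_nhdsWithin_of_mem_nhds hC, C, fun s hs => hs⟩)
  obtain ⟨C, hC⟩ := this
  exact ⟨C, fun t => hC t (mem_univ t)⟩

/-- The grid times `(⌊(n+1)t⌋ + 1)/(n+1)` converge to `t` strictly from the right. -/
lemma tendsto_floor_add_one_div (t : ℝ) :
    Tendsto (fun n : ℕ => ((⌊((n : ℝ) + 1) * t⌋ : ℝ) + 1) / ((n : ℝ) + 1)) atTop (𝓝[>] t) := by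
  have hlt : ∀ n : ℕ, t < ((⌊((n : ℝ) + 1) * t⌋ : ℝ) + 1) / ((n : ℝ) + 1) := fun n => by
    rw [lt_div_iff₀ (by positivity), mul_comm]
    exact Int.lt_floor_add_one _
  refine tendsto_nhdsWithin_iff.2 ⟨?_, Eventually.of_forall hlt⟩
  have hu : Tendsto (fun n : ℕ => t + 1 / ((n : ℝ) + 1)) atTop (𝓝 t) := by
    simpa using tendsto_const_nhds.add (tendsto_one_div_add_atTop_nhds_zero_nat (𝕜 := ℝ))
  refine tendsto_of_tendsto_of_tendsto_of_le_of_le tendsto_const_nhds hu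
    (fun n => (hlt n).le) (fun n => ?_)
  have : (0 : ℝ) < (n : ℝ) + 1 := by positivity
  change _ ≤ t + 1 / ((n : ℝ) + 1)
  rw [div_le_iff₀ this, add_mul t, one_div, inv_mul_cancel₀ this.ne']
  linarith [Int.floor_le (((n : ℝ) + 1) * t)]

/-- A right-continuous real process is jointly measurable. -/
lemma measurable_uncurry_of_rightContinuous {Ω : Type*} [MeasurableSpace Ω] {F : ℝ → Ω → ℝ}
    (hm : ∀ t, Measurable (F t))
    (hc : ∀ ω t, ContinuousWithinAt (fun s => F s ω) (Ioi t) t) :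
    Measurable (fun p : ℝ × Ω => F p.1 p.2) := by
  refine measurable_of_tendsto_metrizable
    (f := fun (n : ℕ) (p : ℝ × Ω) => F (((⌊((n : ℝ) + 1) * p.1⌋ : ℝ) + 1) / ((n : ℝ) + 1)) p.2)
    (fun n => ?_) ?_
  · have h1 : Measurable (fun q : ℤ × Ω => F (((q.1 : ℝ) + 1) / ((n : ℝ) + 1)) q.2) :=
      measurable_from_prod_countable_right fun k =>
        hm (((k : ℝ) + 1) / ((n : ℝ) + 1))
    exact h1.comp (((Int.measurable_floor.comp (measurable_const.mul measurable_fst))).prodMk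
      measurable_snd)
  · rw [tendsto_pi_nhds]
    intro p
    exact (hc p.2 p.1).tendsto.comp (tendsto_floor_add_one_div p.1)

lemma measurable_of_rightContinuous {F : ℝ → ℝ}
    (hc : ∀ t, ContinuousWithinAt F (Ioi t) t) : Measurable F :=
  (measurable_uncurry_of_rightContinuous (Ω := Unit) (F := fun t _ => F t)
    (fun _ => measurable_const) (fun _ t => hc t)).comp
    (measurable_id.prodMk (measurable_const (a := ())))

lemma IsCadlag.intervalIntegrable {T : ℝ} (hT : 0 ≤ T) {F : Icc (0 : ℝ) T → ℝ} (hF : IsCadlag F)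
    (a b : ℝ) : IntervalIntegrable (fun s => F (projIcc 0 T hT s)) volume a b := by
  obtain ⟨C, hC⟩ := hF.exists_abs_le
  have hm : Measurable (fun s => F (projIcc 0 T hT s)) := measurable_of_rightContinuous
    (hF.rightContinuous_comp continuous_projIcc (monotone_projIcc hT))
  exact (intervalIntegrable_const (c := C)).mono_fun hm.aestronglyMeasurable
    (ae_of_all _ fun s => by simpa using (hC _).trans (le_abs_self C))

/-! ### Iterated integral inequalities -/

/-- If each function of a chain is within `ε` of the integral of the next one, and the `n`-th
one is bounded, then the first is small. The weight `exp (c t)`, `c ≥ 2`, gains a factor `1 / c`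
in each integration. -/
lemma abs_le_of_iterated_integral {T c ε R : ℝ} (hc : 2 ≤ c) (hε : 0 ≤ ε) (hR : 0 ≤ R) (n : ℕ) :
    ∀ a : ℕ → ℝ → ℝ,
      (∀ k < n, ∀ t ∈ Icc 0 T, |a k t| ≤ ε + |∫ s in (0 : ℝ)..t, a (k + 1) s|) →
      (∀ t ∈ Icc 0 T, |a n t| ≤ R) →
      ∀ t ∈ Icc 0 T, |a 0 t| ≤ (2 * ε + R / c ^ n) * Real.exp (c * t) := by
  have hc0 : 0 < c := by linarith
  induction n with
  | zero =>
    intro a _ h t ht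
    have h1 : 1 ≤ Real.exp (c * t) := Real.one_le_exp (mul_nonneg hc0.le ht.1)
    calc |a 0 t| ≤ R := h t ht
      _ ≤ (2 * ε + R / c ^ 0) * 1 := by simp [hε]
      _ ≤ _ := by gcongr
  | succ n ih =>
    intro a h1 h2 t ht
    have hB : 0 ≤ 2 * ε + R / c ^ n := by positivity
    have h3 := ih (fun k => a (k + 1)) (fun k hk => h1 (k + 1) (by omega)) h2
    have h4 : |∫ s in (0 : ℝ)..t, a 1 s| ≤ (2 * ε + R / c ^ n) / c * Real.exp (c * t) := by
      have hint : IntervalIntegrable (fun s => (2 * ε + R / c ^ n) * Real.exp (c * s))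
        volume 0 t := Continuous.intervalIntegrable (by fun_prop) _ _
      have h5 := intervalIntegral.norm_integral_le_of_norm_le (f := a 1) ht.1
        (ae_of_all _ fun s hs => h3 s ⟨hs.1.le, hs.2.trans ht.2⟩) hint
      refine h5.trans ?_
      rw [intervalIntegral.integral_const_mul,
        intervalIntegral.integral_comp_mul_left (fun s => Real.exp s) hc0.ne', integral_exp]
      simp only [mul_zero, Real.exp_zero, smul_eq_mul]
      rw [div_mul_eq_mul_div, mul_div_assoc, ← div_eq_inv_mul]
      gcongr
      linarith
    have h5 : 1 ≤ Real.exp (c * t) := Real.one_le_exp (mul_nonneg hc0.le ht.1)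
    calc |a 0 t| ≤ ε * 1 + (2 * ε + R / c ^ n) / c * Real.exp (c * t) := by
          linarith [h1 0 (by omega) t ht]
      _ ≤ ε * Real.exp (c * t) + (2 * ε + R / c ^ n) / c * Real.exp (c * t) := by gcongr
      _ = (ε + 2 * ε / c + R / c ^ (n + 1)) * Real.exp (c * t) := by
          rw [pow_succ]; field_simp; ring
      _ ≤ _ := by
          gcongr
          have : 2 * ε / c ≤ ε := by rw [div_le_iff₀ hc0]; nlinarith
          linarith

/-! ### The drift operator -/

lemma norm_integral_unitInterval_le {f : I → ℝ} {C : ℝ} (h : ∀ x, |f x| ≤ C) :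
    |∫ x, f x| ≤ C := by
  simpa using norm_integral_le_of_norm_le_const (μ := (volume : Measure I))
    (ae_of_all _ fun x => (Real.norm_eq_abs (f x)).trans_le (h x))

lemma integrable_of_continuous {f : I → ℝ} (hf : Continuous f) : Integrable f :=
  hf.integrable_of_hasCompactSupport (HasCompactSupport.of_compactSpace f)

lemma abs_apply_le_norm {X : Type*} [TopologicalSpace X] [CompactSpace X] (f : C(X, ℝ)) (x : X) :
    |f x| ≤ ‖f‖ := f.norm_coe_le_norm x

lemma norm_P₁_le (lam : C(I × I, ℝ)) (f : C(I, ℝ)) : ‖P₁ lam f‖ ≤ ‖lam‖ * ‖f‖ := by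
  refine (ContinuousMap.norm_le _ (by positivity)).2 fun x => ?_
  refine norm_integral_unitInterval_le fun y => ?_
  rw [abs_mul]
  gcongr
  · exact abs_apply_le_norm _ _
  · exact abs_apply_le_norm _ _

lemma norm_P₂_le (lam : C(I × I, ℝ)) (f : C(I, ℝ)) : ‖P₂ lam f‖ ≤ ‖lam‖ * ‖f‖ := by
  refine (ContinuousMap.norm_le _ (by positivity)).2 fun x => ?_
  change |f x * ∫ y : I, lam (x, y)| ≤ _
  rw [abs_mul, mul_comm]
  gcongr
  · exact norm_integral_unitInterval_le fun y => abs_apply_le_norm _ _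
  · exact abs_apply_le_norm _ _

/-- The operator `P₁ - P₂` on `C[0,1]`. -/
def drift (lam : C(I × I, ℝ)) (f : C(I, ℝ)) : C(I, ℝ) := P₁ lam f - P₂ lam f

lemma drift_apply (lam : C(I × I, ℝ)) (f : C(I, ℝ)) (x : I) :
    drift lam f x = ∫ y : I, lam (x, y) * (f y - f x) := by
  change (∫ y : I, lam (x, y) * f y) - f x * ∫ y : I, lam (x, y) = _
  rw [← integral_const_mul, ← integral_sub]
  · congr 1; ext y; ring
  · exact integrable_of_continuous (by fun_prop)
  · exact integrable_of_continuous (by fun_prop)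

lemma norm_drift_le (lam : C(I × I, ℝ)) (f : C(I, ℝ)) :
    ‖drift lam f‖ ≤ 2 * ‖lam‖ * ‖f‖ := by
  refine (norm_sub_le _ _).trans ?_
  linarith [norm_P₁_le lam f, norm_P₂_le lam f]

lemma norm_iterate_drift_le (lam : C(I × I, ℝ)) (f : C(I, ℝ)) (n : ℕ) :
    ‖(drift lam)^[n] f‖ ≤ (2 * ‖lam‖) ^ n * ‖f‖ := by
  induction n with
  | zero => simp
  | succ n ih =>
    rw [Function.iterate_succ_apply']
    refine (norm_drift_le _ _).trans ?_
    rw [pow_succ', mul_assoc (2 * ‖lam‖)]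
    gcongr

/-- The stability estimate for the limit equation: a family of functionals bounded by `C` that
solves the homogeneous equation up to `ε`, when tested against the first `n` functions
`f, (P₁ - P₂) f, …`, is small. -/
lemma abs_le_of_approx_solution (lam : C(I × I, ℝ)) {T C ε : ℝ} (hC : 0 ≤ C) (hε : 0 ≤ ε)
    (D : ℝ → C(I, ℝ) → ℝ) (f : C(I, ℝ)) (n : ℕ)
    (hD : ∀ t ∈ Icc 0 T, ∀ g, |D t g| ≤ C * ‖g‖)
    (h : ∀ k < n, ∀ t ∈ Icc 0 T, |D t ((drift lam)^[k] f) -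
      ∫ s in (0 : ℝ)..t, D s (drift lam ((drift lam)^[k] f))| ≤ ε) :
    ∀ t ∈ Icc 0 T, |D t f| ≤
      (2 * ε + C * ‖f‖ * (1 / 2) ^ n) * Real.exp (2 * (2 * ‖lam‖ + 1) * T) := by
  intro t ht
  set c : ℝ := 2 * (2 * ‖lam‖ + 1) with hcdef
  have hl := norm_nonneg lam
  have hc : 2 ≤ c := by rw [hcdef]; linarith
  have hc0 : 0 < c := by linarith
  have := abs_le_of_iterated_integral (T := T) (R := C * ((2 * ‖lam‖) ^ n * ‖f‖)) hc hε
    (by positivity) n (fun k t => D t ((drift lam)^[k] f))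
    (fun k hk t ht => by
      simp only [Function.iterate_succ_apply']
      have h1 := h k hk t ht
      have h2 := abs_sub_abs_le_abs_sub (D t ((drift lam)^[k] f))
        (∫ s in (0 : ℝ)..t, D s (drift lam ((drift lam)^[k] f)))
      linarith)
    (fun t ht => (hD t ht _).trans
      (mul_le_mul_of_nonneg_left (norm_iterate_drift_le lam f n) hC)) t ht
  refine this.trans ?_
  have h1 : (2 * ‖lam‖) ^ n / c ^ n ≤ (1 / 2) ^ n := by
    rw [← div_pow]
    refine pow_le_pow_left₀ (by positivity) ?_ n
    rw [div_le_iff₀ hc0, hcdef]; linarith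
  have h2 : C * ((2 * ‖lam‖) ^ n * ‖f‖) / c ^ n ≤ C * ‖f‖ * (1 / 2) ^ n := by
    calc C * ((2 * ‖lam‖) ^ n * ‖f‖) / c ^ n = C * ‖f‖ * ((2 * ‖lam‖) ^ n / c ^ n) := by ring
      _ ≤ _ := by gcongr
  gcongr
  exact ht.2

/-! ### The limit equation -/

/-- The functional `f ↦ ∫ f g dx` on `C[0,1]`. -/
def pairing (g : C(I, ℝ)) : C(I, ℝ) →L[ℝ] ℝ :=
  LinearMap.mkContinuous
    { toFun := fun f => ∫ x : I, f x * g x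
      map_add' := fun f f' => by
        rw [← integral_add (integrable_of_continuous (by fun_prop))
          (integrable_of_continuous (by fun_prop))]
        simp [add_mul]
      map_smul' := fun c f => by
        simp [mul_assoc, integral_const_mul] } ‖g‖ fun f => by
    refine norm_integral_unitInterval_le fun x => ?_
    rw [abs_mul, mul_comm]
    gcongr
    · exact abs_apply_le_norm _ _
    · exact abs_apply_le_norm _ _

lemma pairing_apply (g f : C(I, ℝ)) : pairing g f = ∫ x : I, f x * g x := rfl

lemma pairing_comm (g f : C(I, ℝ)) : pairing g f = pairing f g := by
  simp only [pairing_apply, mul_comm]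

/-- The operator `(P₁ - P₂)*` acting on densities:
`ρ ↦ ∫ λ(y, ·) ρ(y) dy - ρ ∫ λ(·, y) dy`. -/
def densityGenerator (lam : C(I × I, ℝ)) : C(I, ℝ) →L[ℝ] C(I, ℝ) :=
  LinearMap.mkContinuous
    { toFun := fun g => P₁ (lam.comp ⟨Prod.swap, continuous_swap⟩) g - P₂ lam g
      map_add' := fun f g => by
        ext x
        change (∫ y : I, lam (y, x) * (f y + g y)) - (f x + g x) * (∫ y : I, lam (x, y)) =
          ((∫ y : I, lam (y, x) * f y) - f x * (∫ y : I, lam (x, y))) +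
          ((∫ y : I, lam (y, x) * g y) - g x * (∫ y : I, lam (x, y)))
        simp only [mul_add]
        rw [integral_add (integrable_of_continuous (by fun_prop))
          (integrable_of_continuous (by fun_prop))]
        ring
      map_smul' := fun c f => by
        ext x
        change (∫ y : I, lam (y, x) * (c * f y)) - (c * f x) * (∫ y : I, lam (x, y)) =
          c * ((∫ y : I, lam (y, x) * f y) - f x * (∫ y : I, lam (x, y)))
        simp only [mul_left_comm _ c]
        rw [integral_const_mul]
        ring } (‖lam.comp ⟨Prod.swap, continuous_swap⟩‖ + ‖lam‖) fun f => by
    refine (norm_sub_le _ _).trans ?_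
    rw [add_mul]
    exact add_le_add (norm_P₁_le _ f) (norm_P₂_le lam f)

lemma densityGenerator_apply (lam : C(I × I, ℝ)) (g : C(I, ℝ)) (x : I) :
    densityGenerator lam g x =
      (∫ y : I, lam (y, x) * g y) - g x * ∫ y : I, lam (x, y) := rfl

/-- The two operators are dual to each other, by Fubini's theorem. -/
lemma pairing_densityGenerator (lam : C(I × I, ℝ)) (f g : C(I, ℝ)) :
    pairing (densityGenerator lam g) f = pairing g (drift lam f) := by
  have h1 : ∀ x : I, drift lam f x = (∫ y : I, lam (x, y) * f y) - f x * ∫ y : I, lam (x, y) :=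
    fun x => rfl
  have hc1 : Continuous fun x => ∫ y : I, lam (y, x) * g y :=
    (P₁ (lam.comp ⟨Prod.swap, continuous_swap⟩) g).continuous
  have hc2 : Continuous fun x => ∫ y : I, lam (x, y) * f y := (P₁ lam f).continuous
  have hc3 : Continuous fun x => f x * ∫ y : I, lam (x, y) := (P₂ lam f).continuous
  have hc4 : Continuous fun x => g x * ∫ y : I, lam (x, y) := (P₂ lam g).continuous
  simp only [pairing_apply, densityGenerator_apply, h1, mul_sub, sub_mul]
  rw [integral_sub (integrable_of_continuous (by fun_prop))
      (integrable_of_continuous (by fun_prop)),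
    integral_sub (integrable_of_continuous (by fun_prop))
      (integrable_of_continuous (by fun_prop))]
  congr 1
  · simp only [← integral_const_mul, ← integral_mul_const]
    rw [integral_integral_swap]
    · congr 1; ext y; congr 1; ext x; ring
    · have : Continuous (Function.uncurry fun x y : I => f x * (lam (y, x) * g y)) := by
        fun_prop
      exact this.integrable_of_hasCompactSupport (HasCompactSupport.of_compactSpace _)
  · congr 1; ext x; ring

/-- The solution `exp (t A) v` of the linear equation `u' = A u`, `u 0 = v`. -/
def expFlow {E : Type*} [NormedAddCommGroup E] [NormedSpace ℝ E] (A : E →L[ℝ] E) (v : E)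
    (t : ℝ) : E :=
  NormedSpace.exp (t • A) v

lemma expFlow_zero {E : Type*} [NormedAddCommGroup E] [NormedSpace ℝ E] (A : E →L[ℝ] E)
    (v : E) : expFlow A v 0 = v := by
  simp [expFlow]

lemma hasDerivAt_expFlow {E : Type*} [NormedAddCommGroup E] [NormedSpace ℝ E] [CompleteSpace E]
    (A : E →L[ℝ] E) (v : E) (t : ℝ) : HasDerivAt (expFlow A v) (A (expFlow A v t)) t :=
  (ContinuousLinearMap.apply ℝ E v).hasFDerivAt.comp_hasDerivAt t
    (hasDerivAt_exp_smul_const' (𝕂 := ℝ) A t)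

/-- The density `ρ_t = exp (t (P₁ - P₂)*) φ`. -/
def density (lam : C(I × I, ℝ)) (φ : C(I, ℝ)) (t : ℝ) : C(I, ℝ) :=
  expFlow (densityGenerator lam) φ t

lemma hasDerivAt_density (lam : C(I × I, ℝ)) (φ : C(I, ℝ)) (t : ℝ) :
    HasDerivAt (density lam φ) (densityGenerator lam (density lam φ t)) t :=
  hasDerivAt_expFlow _ _ _

lemma continuous_density (lam : C(I × I, ℝ)) (φ : C(I, ℝ)) : Continuous (density lam φ) :=
  continuous_iff_continuousAt.2 fun t => (hasDerivAt_density lam φ t).continuousAt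

lemma density_zero (lam : C(I × I, ℝ)) (φ : C(I, ℝ)) : density lam φ 0 = φ := by
  exact expFlow_zero _ _

lemma solvesDensityEquation_density (lam : C(I × I, ℝ)) (φ : C(I, ℝ)) (T : ℝ) :
    SolvesDensityEquation lam φ T (fun t x => density lam φ t x) where
  continuousOn := by
    refine Continuous.continuousOn ?_
    have := continuous_density lam φ
    fun_prop
  initial x := by rw [density_zero]
  hasDeriv t _ x :=
    (((ContinuousMap.evalCLM ℝ x : C(I, ℝ) →L[ℝ] ℝ).hasFDerivAt.comp_hasDerivAt t
      (hasDerivAt_density lam φ t)).hasDerivWithinAt : HasDerivWithinAt _ _ (Icc 0 T) t)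

/-- The path of measures `ρ_t(x) dx`. -/
def limitPath (lam : C(I × I, ℝ)) (φ : C(I, ℝ)) (T : ℝ) : SkorokhodSpace T where
  toFun t := StrongDual.toWeakDual (pairing (density lam φ t))
  cadlag := by
    refine isCadlag_of_continuous (WeakDual.continuous_of_continuous_eval fun f => ?_)
    change Continuous fun t : Icc (0 : ℝ) T => pairing (density lam φ t) f
    simp only [pairing_comm _ f]
    exact (pairing f).continuous.comp ((continuous_density lam φ).comp continuous_subtype_val)

lemma limitPath_apply (lam : C(I × I, ℝ)) (φ : C(I, ℝ)) {T : ℝ} (t : Icc (0 : ℝ) T)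
    (f : C(I, ℝ)) : limitPath lam φ T t f = pairing (density lam φ t) f := rfl

/-- The weak form of the equation for the density, valid at all times. -/
lemma pairing_density_eq (lam : C(I × I, ℝ)) (φ : C(I, ℝ)) (t : ℝ) (f : C(I, ℝ)) :
    pairing (density lam φ t) f = pairing φ f +
      ∫ s in (0 : ℝ)..t, pairing (density lam φ s) (drift lam f) := by
  have hd : ∀ s, HasDerivAt (fun s => pairing (density lam φ s) f)
      (pairing (density lam φ s) (drift lam f)) s := fun s => by
    rw [← pairing_densityGenerator]
    simp only [pairing_comm _ f]
    exact (pairing f).hasFDerivAt.comp_hasDerivAt s (hasDerivAt_density lam φ s)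
  have hc : Continuous fun s => pairing (density lam φ s) (drift lam f) := by
    simp only [pairing_comm _ (drift lam f)]
    exact (pairing _).continuous.comp (continuous_density lam φ)
  rw [intervalIntegral.integral_eq_sub_of_hasDerivAt (fun s _ => hd s)
    (hc.intervalIntegrable _ _), density_zero]
  ring

lemma isWeakSolution_limitPath (lam : C(I × I, ℝ)) (φ : C(I, ℝ)) {T : ℝ} (hT : 0 < T) :
    IsWeakSolution lam φ hT (limitPath lam φ T) := by
  intro t f
  rw [limitPath_apply, pairing_density_eq, pairing_apply]
  congr 1
  refine intervalIntegral.integral_congr fun s hs => ?_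
  rw [uIcc_of_le t.2.1] at hs
  change _ = limitPath lam φ T _ (drift lam f)
  rw [limitPath_apply, projIcc_of_mem hT.le ⟨hs.1, hs.2.trans t.2.2⟩]

lemma SkorokhodSpace.isCadlag_apply {T : ℝ} (ν : SkorokhodSpace T) (f : C(I, ℝ)) :
    IsCadlag (fun t => ν t f) :=
  ν.cadlag.comp_continuous (WeakDual.eval_continuous f)

/-- The norms of the functionals of a càdlàg path are bounded, by the uniform boundedness
principle. -/
lemma SkorokhodSpace.exists_abs_apply_le {T : ℝ} (ν : SkorokhodSpace T) :
    ∃ C, 0 ≤ C ∧ ∀ t f, |ν t f| ≤ C * ‖f‖ := by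
  obtain ⟨C, hC⟩ := banach_steinhaus (g := fun t => WeakDual.toStrongDual (ν t)) fun f => by
    obtain ⟨C, hC⟩ := (ν.isCadlag_apply f).exists_abs_le
    exact ⟨C, hC⟩
  refine ⟨max C 0, le_max_right _ _, fun t f => ?_⟩
  refine ((WeakDual.toStrongDual (ν t)).le_opNorm f).trans ?_
  gcongr
  exact (hC t).trans (le_max_left _ _)

lemma tendsto_stability_bound (C B : ℝ) :
    Tendsto (fun n : ℕ => C * (1 / 2 : ℝ) ^ n * B) atTop (𝓝 0) := by
  have := tendsto_pow_atTop_nhds_zero_of_lt_one (r := (1 / 2 : ℝ)) (by norm_num) (by norm_num)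
  simpa using (this.const_mul C).mul_const B

lemma IsWeakSolution.unique {lam : C(I × I, ℝ)} {φ : C(I, ℝ)} {T : ℝ} {hT : 0 < T}
    {μ ν : SkorokhodSpace T} (hμ : IsWeakSolution lam φ hT μ) (hν : IsWeakSolution lam φ hT ν) :
    ν = μ := by
  obtain ⟨C, hC, hνC⟩ := ν.exists_abs_apply_le
  obtain ⟨C', hC', hμC⟩ := μ.exists_abs_apply_le
  ext t : 2
  refine ContinuousLinearMap.ext fun f => ?_
  have hb : ∀ n : ℕ, |ν t f - μ t f| ≤
      (C + C') * ‖f‖ * (1 / 2) ^ n * Real.exp (2 * (2 * ‖lam‖ + 1) * T) := fun n => by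
    have := abs_le_of_approx_solution lam (T := T) (C := C + C') (by positivity) le_rfl
      (fun s g => ν (projIcc 0 T hT.le s) g - μ (projIcc 0 T hT.le s) g) f n
      (fun s hs g => by
        refine (abs_sub _ _).trans ?_
        rw [add_mul]
        exact add_le_add (hνC _ _) (hμC _ _))
      (fun k hk s hs => by
        rw [intervalIntegral.integral_sub
          ((ν.isCadlag_apply _).intervalIntegrable hT.le _ _)
          ((μ.isCadlag_apply _).intervalIntegrable hT.le _ _)]
        have h1 := hν ⟨s, hs⟩ ((drift lam)^[k] f)
        have h2 := hμ ⟨s, hs⟩ ((drift lam)^[k] f)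
        rw [projIcc_of_mem hT.le hs, h1, h2]
        simp [drift]) t t.2
    simpa using this
  have h0 : |ν t f - μ t f| ≤ 0 :=
    ge_of_tendsto' (tendsto_stability_bound _ _) hb
  exact sub_eq_zero.1 (abs_nonpos_iff.1 h0)

/-! ### Riemann sums -/

lemma integral_unitInterval_eq (g : I → ℝ) :
    ∫ x : I, g x = ∫ y in (0 : ℝ)..1, g (projIcc 0 1 zero_le_one y) := by
  rw [intervalIntegral.integral_of_le zero_le_one, ← integral_Icc_eq_integral_Ioc,
    ← integral_subtype measurableSet_Icc]
  refine integral_congr_ae (ae_of_all _ fun x => ?_)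
  change g x = g (projIcc 0 1 zero_le_one x)
  rw [projIcc_val]

lemma abs_riemannSum_sub_integral_le {g : I → ℝ} (hg : Continuous g) {N : ℕ} (hN : 0 < N)
    {ε : ℝ} (h : ∀ u v : I, |(u : ℝ) - v| ≤ 1 / N → |g u - g v| ≤ ε) :
    |(1 / N : ℝ) * ∑ i : Fin N, g (loc i) - ∫ x : I, g x| ≤ ε := by
  have hN' : (0 : ℝ) < N := by exact_mod_cast hN
  set G : ℝ → ℝ := fun y => g (projIcc 0 1 zero_le_one y) with hG
  have hGc : Continuous G := hg.comp continuous_projIcc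
  have hsum : ∫ x : I, g x =
      ∑ i : Fin N, ∫ y in ((i : ℕ) : ℝ) / N..((i : ℕ) + 1 : ℝ) / N, G y := by
    have h1 := intervalIntegral.sum_integral_adjacent_intervals (f := G) (μ := volume)
      (a := fun k : ℕ => (k : ℝ) / N) (n := N) (fun k _ => hGc.intervalIntegrable _ _)
    rw [integral_unitInterval_eq, ← Fin.sum_univ_eq_sum_range
      (fun k => ∫ y in ((k : ℕ) : ℝ) / N..((k + 1 : ℕ) : ℝ) / N, G y)] at *
    simp only [Nat.cast_zero, zero_div, div_self hN'.ne', Nat.cast_add, Nat.cast_one] at h1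
    exact h1.symm
  rw [hsum, Finset.mul_sum, ← Finset.sum_sub_distrib]
  have hterm : ∀ i : Fin N, |1 / (N : ℝ) * g (loc i) -
      ∫ y in ((i : ℕ) : ℝ) / N..((i : ℕ) + 1 : ℝ) / N, G y| ≤ ε / N := by
    intro i
    have hlen : ((i : ℕ) + 1 : ℝ) / N - ((i : ℕ) : ℝ) / N = 1 / N := by ring
    have h1 : 1 / (N : ℝ) * g (loc i) =
        ∫ y in ((i : ℕ) : ℝ) / N..((i : ℕ) + 1 : ℝ) / N, g (loc i) := by
      rw [intervalIntegral.integral_const, hlen, smul_eq_mul]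
    rw [h1, ← intervalIntegral.integral_sub (by simp) (hGc.intervalIntegrable _ _)]
    have h2 := intervalIntegral.norm_integral_le_of_norm_le_const
      (a := ((i : ℕ) : ℝ) / N) (b := ((i : ℕ) + 1 : ℝ) / N)
      (f := fun y => g (loc i) - G y) (C := ε) (fun y hy => by
        have hle : ((i : ℕ) : ℝ) / N ≤ ((i : ℕ) + 1 : ℝ) / N := by gcongr; linarith
        rw [uIoc_of_le hle] at hy
        have h0 : 0 ≤ y := le_trans (by positivity) hy.1.le
        have hl : ((loc i : I) : ℝ) = ((i : ℕ) + 1 : ℝ) / N := rfl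
        have hy1 : y ≤ 1 := hy.2.trans (by rw [← hl]; exact (loc i).2.2)
        refine h _ _ ?_
        rw [projIcc_of_mem zero_le_one ⟨h0, hy1⟩, hl, abs_of_nonneg (by linarith [hy.2])]
        linarith [hy.1])
    rw [hlen, abs_of_pos (by positivity), mul_one_div] at h2
    exact h2
  refine (Finset.abs_sum_le_sum_abs _ _).trans ((Finset.sum_le_sum fun i _ => hterm i).trans ?_)
  rw [Finset.sum_const, Finset.card_univ, Fintype.card_fin, nsmul_eq_mul]
  field_simp
  exact le_rfl

/-- Riemann sums converge uniformly over a parameter. -/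
lemma eventually_abs_riemannSum_sub_integral_le (G : C(I × I, ℝ)) {ε : ℝ} (hε : 0 < ε) :
    ∀ᶠ N : ℕ in atTop, ∀ x : I,
      |(1 / N : ℝ) * ∑ i : Fin N, G (x, loc i) - ∫ y : I, G (x, y)| ≤ ε := by
  have huc : UniformContinuous G := CompactSpace.uniformContinuous_of_continuous G.continuous
  obtain ⟨δ, hδ, h⟩ := Metric.uniformContinuous_iff.1 huc ε hε
  have h1 : ∀ᶠ N : ℕ in atTop, (1 / N : ℝ) < δ :=
    tendsto_one_div_atTop_nhds_zero_nat.eventually (gt_mem_nhds hδ)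
  filter_upwards [h1, eventually_gt_atTop 0] with N hN hN0 x
  refine abs_riemannSum_sub_integral_le (g := fun y => G (x, y)) (by fun_prop) hN0
    fun u v huv => ?_
  refine (h (a := (x, u)) (b := (x, v)) ?_).le
  rw [Prod.dist_eq, dist_self]
  exact max_lt hδ (huv.trans_lt hN)

lemma tendsto_riemannSum {g : I → ℝ} (hg : Continuous g) :
    Tendsto (fun N : ℕ => (1 / N : ℝ) * ∑ i : Fin N, g (loc i)) atTop (𝓝 (∫ x : I, g x)) := by
  rw [Metric.tendsto_nhds]
  intro ε hε
  filter_upwards [eventually_abs_riemannSum_sub_integral_le ⟨fun p : I × I => g p.2, by fun_prop⟩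
    (half_pos hε)] with N hN
  exact (hN 0).trans_lt (half_lt_self hε)

/-- The discretization of the operator `P₁ - P₂` with `N` boxes. -/
def discreteDrift (lam : C(I × I, ℝ)) (N : ℕ) (f : C(I, ℝ)) : C(I, ℝ) where
  toFun x := (1 / N : ℝ) * ∑ j : Fin N, lam (x, loc j) * (f (loc j) - f x)

lemma eventually_norm_discreteDrift_sub_le (lam : C(I × I, ℝ)) (f : C(I, ℝ)) {ε : ℝ}
    (hε : 0 < ε) :
    ∀ᶠ N : ℕ in atTop, ‖discreteDrift lam N f - drift lam f‖ ≤ ε := by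
  filter_upwards [eventually_abs_riemannSum_sub_integral_le
    ⟨fun p : I × I => lam p * (f p.2 - f p.1), by fun_prop⟩ hε] with N hN
  refine (ContinuousMap.norm_le _ hε.le).2 fun x => ?_
  rw [ContinuousMap.sub_apply, drift_apply]
  exact hN x

/-! ### Step paths in the Skorokhod space -/

/-- A càdlàg path in a discrete space jumps at finitely many times only. -/
lemma IsCadlag.exists_jumps {E : Type*} [TopologicalSpace E] [DiscreteTopology E] {T : ℝ}
    {x : Icc (0 : ℝ) T → E} (hx : IsCadlag x) :
    ∃ J : Finset ℝ, ∀ t t' : Icc (0 : ℝ) T, (∀ j ∈ J, (j ≤ t ↔ j ≤ t')) → x t = x t' := by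
  classical
  -- A local jump set also controls comparisons with later times outside the local set: this
  -- makes the property stable under unions.
  have key := isCompact_univ (X := Icc (0 : ℝ) T).induction_on
    (p := fun s => ∃ J : Finset ℝ, ∀ t ∈ s, ∀ t' : Icc (0 : ℝ) T, t ≤ t' →
      (∀ j ∈ J, j ≤ t' → j ≤ t) → x t = x t')
    ⟨∅, by simp⟩ (fun s u hsu ⟨J, hJ⟩ => ⟨J, fun t ht => hJ t (hsu ht)⟩)
    (fun s u ⟨J, hJ⟩ ⟨J', hJ'⟩ => ⟨J ∪ J', fun t ht t' htt' h => ht.elim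
      (fun hs => hJ t hs t' htt' fun j hj => h j (Finset.mem_union_left _ hj))
      (fun hs => hJ' t hs t' htt' fun j hj => h j (Finset.mem_union_right _ hj))⟩)
    (fun a _ => by
      obtain ⟨h1, l, h2⟩ := hx a
      have h1' : Tendsto x (𝓝[>] a) (𝓝 (x a)) := h1
      have h2' := h2
      rw [nhds_discrete, tendsto_pure] at h1' h2'
      obtain ⟨δ, hδ, h1'⟩ := Metric.mem_nhdsWithin_iff.1 h1'
      obtain ⟨δ', hδ', h2'⟩ := Metric.mem_nhdsWithin_iff.1 h2'
      refine ⟨Metric.ball a (min δ δ'), mem_nhdsWithin_of_mem_nhds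
        (Metric.ball_mem_nhds _ (lt_min hδ hδ')), {(a : ℝ), (a : ℝ) + δ}, ?_⟩
      intro t ht t' htt' hj
      have hja := hj a (by simp)
      have hjb := hj (a + δ) (by simp)
      rw [Metric.mem_ball, Subtype.dist_eq, Real.dist_eq, abs_lt] at ht
      have hm1 := min_le_left δ δ'
      have hm2 := min_le_right δ δ'
      have ht' : (t' : ℝ) < a + δ := by
        by_contra hcon
        have := hjb (not_lt.1 hcon)
        linarith [ht.2]
      have htt'' : (t : ℝ) ≤ t' := htt'
      have hright : ∀ s : Icc (0 : ℝ) T, (a : ℝ) ≤ s → (s : ℝ) < a + δ → x s = x a := by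
        intro s hs hs'
        rcases hs.eq_or_lt with h | h
        · rw [Subtype.ext h]
        · refine h1' ⟨?_, h⟩
          rw [Metric.mem_ball, Subtype.dist_eq, Real.dist_eq, abs_lt]
          constructor <;> linarith
      have hleft : ∀ s : Icc (0 : ℝ) T, (s : ℝ) < a → (a : ℝ) - δ' < s → x s = l := by
        intro s hs hs'
        refine h2' ⟨?_, hs⟩
        rw [Metric.mem_ball, Subtype.dist_eq, Real.dist_eq, abs_lt]
        constructor <;> linarith
      rcases le_or_gt (a : ℝ) t' with h | h
      · rw [hright t' h ht', hright t (hja h) (by linarith)]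
      · rw [hleft t' h (by linarith [ht.1]), hleft t (by linarith) (by linarith [ht.1])])
  obtain ⟨J, hJ⟩ := key
  refine ⟨J, fun t t' h => ?_⟩
  rcases le_total t t' with htt | htt
  · exact hJ t (mem_univ _) t' htt fun j hj => (h j hj).2
  · exact (hJ t' (mem_univ _) t htt fun j hj => (h j hj).1).symm

/-- The tent function of height and half-width one. -/
def tent (u : ℝ) : ℝ := max 0 (1 - |u|)

lemma tent_nonneg (u : ℝ) : 0 ≤ tent u := le_max_left _ _

lemma tent_le_one (u : ℝ) : tent u ≤ 1 := max_le zero_le_one (by linarith [abs_nonneg u])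

lemma tent_zero : tent 0 = 1 := by simp [tent]

lemma tent_of_one_le_abs {u : ℝ} (h : 1 ≤ |u|) : tent u = 0 := max_eq_left (by linarith)

lemma continuous_tent : Continuous tent := by unfold tent; fun_prop

lemma abs_tent_sub_le (u v : ℝ) : |tent u - tent v| ≤ |u - v| := by
  unfold tent
  refine (abs_max_sub_max_le_max _ _ _ _).trans ?_
  rw [sub_self, abs_zero, sub_sub_sub_cancel_left]
  refine max_le (abs_nonneg _) ?_
  rw [abs_sub_comm u v]
  exact abs_abs_sub_abs_le_abs_sub v u

/-- Finitely many times can be moved slightly by an increasing bijection of `[0,T]`: the identity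
plus a sum of tents, each of which vanishes at the other times. -/
lemma exists_timeChange {T : ℝ} (hT : 0 ≤ T) (J : Finset ℝ) (hJ : ∀ j ∈ J, j ∈ Icc 0 T)
    (h0 : (0 : ℝ) ∈ J) (hTJ : T ∈ J) {w : ℝ} (hw : 0 < w)
    (hsep : ∀ j ∈ J, ∀ j' ∈ J, j ≠ j' → w ≤ |j' - j|) (s : ℝ → ℝ) (hs0 : s 0 = 0) (hsT : s T = T)
    {h : ℝ} (hs : ∀ j ∈ J, |s j - j| ≤ h) (hh : J.card * h < w) :
    ∃ τ : Icc (0 : ℝ) T ≃o Icc (0 : ℝ) T, (∀ t, |(τ t : ℝ) - t| ≤ J.card * h) ∧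
      ∀ j (hj : j ∈ J), (τ ⟨j, hJ j hj⟩ : ℝ) = s j := by
  set p : ℝ → ℝ := fun t => ∑ j ∈ J, (s j - j) * tent ((t - j) / w) with hp
  have hpc : Continuous p := by
    have := continuous_tent
    fun_prop
  have hpb : ∀ t, |p t| ≤ J.card * h := fun t => by
    refine (Finset.abs_sum_le_sum_abs _ _).trans ?_
    rw [← nsmul_eq_mul]
    refine Finset.sum_le_card_nsmul _ _ _ fun j hj => ?_
    rw [abs_mul, abs_of_nonneg (tent_nonneg _)]
    exact (mul_le_of_le_one_right (abs_nonneg _) (tent_le_one _)).trans (hs j hj)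
  have hpl : ∀ t t', |p t - p t'| ≤ J.card * h / w * |t - t'| := fun t t' => by
    simp only [hp]
    rw [← Finset.sum_sub_distrib]
    refine (Finset.abs_sum_le_sum_abs _ _).trans ?_
    have : (J.card : ℝ) * h / w * |t - t'| = J.card * (h * (|t - t'| / w)) := by ring
    rw [this, ← nsmul_eq_mul]
    refine Finset.sum_le_card_nsmul _ _ _ fun j hj => ?_
    rw [← mul_sub, abs_mul]
    have hh : 0 ≤ h := (abs_nonneg _).trans (hs j hj)
    refine mul_le_mul (hs j hj) ((abs_tent_sub_le _ _).trans ?_) (abs_nonneg _) hh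
    rw [← sub_div, abs_div, abs_of_pos hw, sub_sub_sub_cancel_right]
  have hpj : ∀ j ∈ J, p j = s j - j := fun j hj => by
    simp only [hp]
    rw [Finset.sum_eq_single_of_mem j hj, sub_self, zero_div, tent_zero, mul_one]
    intro i hi hij
    rw [tent_of_one_le_abs, mul_zero]
    rw [abs_div, abs_of_pos hw, one_le_div hw]
    exact hsep i hi j hj hij
  set q : ℝ → ℝ := fun t => t + p t with hq
  have hqc : Continuous q := by fun_prop
  have hqm : StrictMono q := fun t t' htt => by
    have h1 := abs_le.1 (hpl t' t)
    have h2 : J.card * h / w < 1 := by rwa [div_lt_one hw]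
    rw [abs_of_pos (sub_pos.2 htt)] at h1
    have h3 := mul_lt_mul_of_pos_right h2 (sub_pos.2 htt)
    change t + p t < t' + p t'
    linarith [h1.1]
  have hqj : ∀ j ∈ J, q j = s j := fun j hj => by simp [hq, hpj j hj]
  have hq0 : q 0 = 0 := by rw [hqj 0 h0, hs0]
  have hqT : q T = T := by rw [hqj T hTJ, hsT]
  let g : Icc (0 : ℝ) T → Icc (0 : ℝ) T := fun t =>
    ⟨q t, hq0.symm.trans_le (hqm.monotone t.2.1), (hqm.monotone t.2.2).trans_eq hqT⟩
  have hg : StrictMono g := fun t t' htt => hqm htt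
  have hgs : Function.Surjective g := fun t => by
    obtain ⟨u, hu, hut⟩ := intermediate_value_Icc hT hqc.continuousOn
      (show (t : ℝ) ∈ Icc (q 0) (q T) by rw [hq0, hqT]; exact t.2)
    exact ⟨⟨u, hu⟩, Subtype.ext hut⟩
  refine ⟨hg.orderIsoOfSurjective g hgs, fun t => ?_, fun j hj => hqj j hj⟩
  change |(t : ℝ) + p t - t| ≤ _
  rw [add_sub_cancel_left]
  exact hpb t

/-- The last point before `t` of the grid that divides `[0,T]` into `n + 1` equal parts. -/
def sampleTime {T : ℝ} (hT : 0 < T) (n : ℕ) (t : Icc (0 : ℝ) T) : Icc (0 : ℝ) T :=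
  ⟨T / (n + 1) * (⌊(t : ℝ) / (T / (n + 1))⌋₊ : ℝ), by positivity, by
    have h : (0 : ℝ) < T / (n + 1) := by positivity
    have h1 := Nat.floor_le (div_nonneg t.2.1 h.le)
    rw [le_div_iff₀ h, mul_comm] at h1
    exact h1.trans t.2.2⟩

/-- The jump times of a step path, with the two end points of the time interval added. -/
lemma IsCadlag.exists_jumps_mem_Icc {E : Type*} [TopologicalSpace E] [DiscreteTopology E] {T : ℝ}
    (hT : 0 ≤ T) {x : Icc (0 : ℝ) T → E} (hx : IsCadlag x) :
    ∃ J : Finset ℝ, (∀ j ∈ J, j ∈ Icc 0 T) ∧ 0 ∈ J ∧ T ∈ J ∧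
      ∀ t t' : Icc (0 : ℝ) T, (∀ j ∈ J, (j ≤ t ↔ j ≤ t')) → x t = x t' := by
  classical
  obtain ⟨J₀, hJ₀⟩ := hx.exists_jumps
  refine ⟨insert 0 (insert T (J₀.filter (fun j => j ∈ Icc 0 T))), ?_, Finset.mem_insert_self _ _,
    Finset.mem_insert_of_mem (Finset.mem_insert_self _ _), ?_⟩
  · intro j hj
    rcases Finset.mem_insert.1 hj with rfl | hj
    · exact ⟨le_rfl, hT⟩
    rcases Finset.mem_insert.1 hj with rfl | hj
    · exact ⟨hT, le_rfl⟩
    · exact (Finset.mem_filter.1 hj).2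
  · intro t t' h
    refine hJ₀ t t' fun j hj => ?_
    by_cases hjI : j ∈ Icc 0 T
    · exact h j (Finset.mem_insert_of_mem (Finset.mem_insert_of_mem
        (Finset.mem_filter.2 ⟨hj, hjI⟩)))
    · rw [mem_Icc, not_and_or, not_le, not_le] at hjI
      rcases hjI with hj0 | hjT
      · exact iff_of_true (hj0.le.trans t.2.1) (hj0.le.trans t'.2.1)
      · exact iff_of_false (fun h => by linarith [t.2.2]) (fun h => by linarith [t'.2.2])

lemma exists_pos_le_abs_sub (J : Finset ℝ) :
    ∃ w : ℝ, 0 < w ∧ ∀ j ∈ J, ∀ j' ∈ J, j ≠ j' → w ≤ |j' - j| := by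
  have h : ∀ S : Finset (ℝ × ℝ), ∃ w : ℝ, 0 < w ∧ ∀ q ∈ S, q.1 ≠ q.2 → w ≤ |q.2 - q.1| := by
    intro S
    induction S using Finset.induction_on with
    | empty => exact ⟨1, one_pos, by simp⟩
    | insert p S _ ih =>
      obtain ⟨w, hw, h⟩ := ih
      by_cases hp : p.1 = p.2
      · refine ⟨w, hw, fun q hq hne => ?_⟩
        rcases Finset.mem_insert.1 hq with rfl | hq
        · exact absurd hp hne
        · exact h q hq hne
      · refine ⟨min w |p.2 - p.1|, lt_min hw (abs_pos.2 (sub_ne_zero.2 (Ne.symm hp))),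
          fun q hq hne => ?_⟩
        rcases Finset.mem_insert.1 hq with rfl | hq
        · exact min_le_right _ _
        · exact (min_le_left _ _).trans (h q hq hne)
  obtain ⟨w, hw, h⟩ := h (J ×ˢ J)
  exact ⟨w, hw, fun j hj j' hj' hne => h (j, j') (Finset.mk_mem_product hj hj') hne⟩

lemma abs_mul_ceil_sub_le {h j : ℝ} (hpos : 0 < h) (hj : 0 ≤ j) :
    |h * (⌈j / h⌉₊ : ℝ) - j| ≤ h := by
  have h1 := Nat.le_ceil (j / h)
  have h2 := Nat.ceil_lt_add_one (div_nonneg hj hpos.le)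
  rw [div_le_iff₀ hpos] at h1
  rw [← sub_lt_iff_lt_add, lt_div_iff₀ hpos] at h2
  rw [abs_of_nonneg (by linarith)]
  linarith

/-- A step path is close to its sampled versions, up to small changes of time: each jump time
is moved to the next grid point. -/
lemma IsCadlag.eventually_sample {E : Type*} [TopologicalSpace E] [DiscreteTopology E] {T : ℝ}
    (hT : 0 < T) {x : Icc (0 : ℝ) T → E} (hx : IsCadlag x) {δ : ℝ} (hδ : 0 < δ) :
    ∀ᶠ n : ℕ in atTop, ∃ τ : Icc (0 : ℝ) T ≃o Icc (0 : ℝ) T,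
      (∀ t, |(τ t : ℝ) - t| < δ) ∧ ∀ t, x (sampleTime hT n (τ t)) = x t := by
  obtain ⟨J, hJmem, h0, hTJ, hJ⟩ := hx.exists_jumps_mem_Icc hT.le
  obtain ⟨w, hw, hsep⟩ := exists_pos_le_abs_sub J
  have hlim : Tendsto (fun n : ℕ => (J.card : ℝ) * (T / ((n : ℝ) + 1))) atTop (𝓝 0) := by
    have := (tendsto_one_div_add_atTop_nhds_zero_nat (𝕜 := ℝ)).const_mul (J.card * T)
    rw [mul_zero] at this
    exact this.congr fun n => by ring
  filter_upwards [hlim.eventually (gt_mem_nhds hw), hlim.eventually (gt_mem_nhds hδ)]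
    with n hn1 hn2
  have hpos : 0 < T / ((n : ℝ) + 1) := by positivity
  have hTn : T / (T / ((n : ℝ) + 1)) = ((n + 1 : ℕ) : ℝ) := by push_cast; field_simp
  obtain ⟨τ, hτ1, hτ2⟩ := exists_timeChange hT.le J hJmem h0 hTJ hw hsep
    (fun j => T / ((n : ℝ) + 1) * (⌈j / (T / ((n : ℝ) + 1))⌉₊ : ℝ)) (by simp)
    (by
      simp only [hTn, Nat.ceil_natCast]
      push_cast
      field_simp)
    (fun j hj => abs_mul_ceil_sub_le hpos (hJmem j hj).1) hn1
  refine ⟨τ, fun t => (hτ1 t).trans_lt hn2, fun t => (hJ _ _ fun j hj => ?_)⟩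
  have e1 : j ≤ (t : ℝ) ↔
      T / ((n : ℝ) + 1) * (⌈j / (T / ((n : ℝ) + 1))⌉₊ : ℝ) ≤ τ t := by
    rw [← hτ2 j hj, Subtype.coe_le_coe, τ.le_iff_le]
    exact Iff.rfl
  have e2 : (sampleTime hT n (τ t) : ℝ) =
      T / ((n : ℝ) + 1) * (⌊(τ t : ℝ) / (T / ((n : ℝ) + 1))⌋₊ : ℝ) := rfl
  rw [e1, e2, mul_comm _ (⌊_⌋₊ : ℝ), mul_comm _ (⌈_⌉₊ : ℝ), ← div_le_iff₀ hpos, ← le_div_iff₀ hpos,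
    ← Nat.le_floor_iff (div_nonneg (τ t).2.1 hpos.le), Nat.ceil_le]

namespace SkorokhodSpace

/-- The paths that agree with `y` after a change of time by less than `δ`. -/
def timeBall {T : ℝ} (y : Icc (0 : ℝ) T → DualC) (δ : ℝ) : Set (SkorokhodSpace T) :=
  {F | ∃ τ : Icc (0 : ℝ) T ≃o Icc (0 : ℝ) T, (∀ t, |(τ t : ℝ) - t| < δ) ∧ ∀ t, F (τ t) = y t}

lemma measurableSet_sample {E Ω : Type*} [MeasurableSpace E] [Countable E]
    [MeasurableSingletonClass E] [MeasurableSpace Ω] {T : ℝ} (hT : 0 < T)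
    {x : Ω → Icc (0 : ℝ) T → E} (hm : ∀ t, Measurable fun ω => x ω t) (n : ℕ)
    (W : Set (Icc (0 : ℝ) T → E)) :
    MeasurableSet {ω | (fun t => x ω (sampleTime hT n t)) ∈ W} := by
  have hfin : Finite (range (sampleTime hT n)) := by
    have hsub : range (sampleTime hT n) ⊆ (fun k : ℕ => projIcc 0 T hT.le (T / (n + 1) * k)) ''
        Iic (n + 1) := by
      rintro _ ⟨t, rfl⟩
      refine ⟨⌊(t : ℝ) / (T / (n + 1))⌋₊, ?_, ?_⟩
      · rw [mem_Iic, ← Nat.lt_succ_iff, Nat.floor_lt (div_nonneg t.2.1 (by positivity)),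
          div_lt_iff₀ (by positivity)]
        push_cast
        have h1 : ((n : ℝ) + 1 + 1) * (T / (n + 1)) = T + T / (n + 1) := by field_simp
        have h2 : 0 < T / ((n : ℝ) + 1) := by positivity
        rw [h1]
        linarith [t.2.2]
      · exact projIcc_of_mem hT.le (sampleTime hT n t).2
    exact ((finite_Iic _).image _).subset hsub
  have hmeas : Measurable fun ω => fun k : range (sampleTime hT n) => x ω k :=
    measurable_pi_lambda _ fun k => hm k
  have : {ω | (fun t => x ω (sampleTime hT n t)) ∈ W} =
      (fun ω => fun k : range (sampleTime hT n) => x ω k) ⁻¹'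
        {v | (fun t => v ⟨sampleTime hT n t, mem_range_self t⟩) ∈ W} := rfl
  rw [this]
  exact hmeas (Set.to_countable _).measurableSet

/-- A random path that takes values in a countable discrete set and is then mapped to the dual
of `C[0,1]` is Borel measurable for the Skorokhod topology: open sets are recovered from the
sampled versions of the path. -/
lemma measurable_of_step {E Ω : Type*} [TopologicalSpace E] [DiscreteTopology E]
    [MeasurableSpace E] [Countable E] [MeasurableSingletonClass E] [MeasurableSpace Ω]
    {T : ℝ} (hT : 0 < T) {x : Ω → Icc (0 : ℝ) T → E} (hx : ∀ ω, IsCadlag (x ω))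
    (hm : ∀ t, Measurable fun ω => x ω t) (g : E → DualC) (Φ : Ω → SkorokhodSpace T)
    (hΦ : ∀ ω t, Φ ω t = g (x ω t)) : Measurable Φ := by
  refine measurable_of_isOpen fun U hU => ?_
  have key : Φ ⁻¹' U = ⋃ k : ℕ, ⋃ m : ℕ, ⋂ n ≥ m, {ω | (fun t => x ω (sampleTime hT n t)) ∈
      {y : Icc (0 : ℝ) T → E | timeBall (fun t => g (y t)) (1 / (k + 1)) ⊆ U}} := by
    ext ω
    simp only [mem_iUnion, mem_iInter, mem_ofPred_eq, mem_preimage]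
    constructor
    · intro hω
      obtain ⟨A, ε, hε, hA⟩ := hU _ hω
      obtain ⟨k, hk⟩ := exists_nat_one_div_lt (half_pos hε)
      obtain ⟨m, hm⟩ := eventually_atTop.1
        ((hx ω).eventually_sample hT (δ := 1 / (k + 1)) (by positivity))
      refine ⟨k, m, fun n hn F hF => hA ?_⟩
      obtain ⟨τ₁, h1, h1'⟩ := hm n hn
      obtain ⟨τ₂, h2, h2'⟩ := hF
      refine ⟨τ₁.trans τ₂, fun t => ?_, fun f _ t => ?_⟩
      · rw [OrderIso.trans_apply]
        calc |(τ₂ (τ₁ t) : ℝ) - t| = |((τ₂ (τ₁ t) : ℝ) - τ₁ t) + (τ₁ t - t)| := by ring_nf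
          _ ≤ |(τ₂ (τ₁ t) : ℝ) - τ₁ t| + |(τ₁ t : ℝ) - t| := abs_add_le _ _
          _ < ε := by linarith [h2 (τ₁ t), h1 t]
      · have h3 : F (τ₂ (τ₁ t)) = Φ ω t := by
          rw [h2', hΦ, ← h1' t]
        rw [OrderIso.trans_apply, h3]
        simpa using hε
    · rintro ⟨k, m, h⟩
      obtain ⟨n, hn, τ, h1, h2⟩ := ((eventually_ge_atTop m).and
        ((hx ω).eventually_sample hT (δ := 1 / (k + 1)) (by positivity))).exists
      refine h n hn ⟨τ.symm, fun t => ?_, fun t => ?_⟩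
      · have := h1 (τ.symm t)
        rwa [τ.apply_symm_apply, abs_sub_comm] at this
      · have := h2 (τ.symm t)
        rw [τ.apply_symm_apply] at this
        rw [hΦ, ← this]
  rw [key]
  exact MeasurableSet.iUnion fun k => MeasurableSet.iUnion fun m => MeasurableSet.iInter fun n =>
    MeasurableSet.iInter fun _ => measurableSet_sample hT hm n _

/-- Convergence in probability, uniformly in time for each test function, implies convergence in
distribution to a deterministic path. -/
lemma tendstoInDistribution_of_uniform {ι : Type*} {l : Filter ι} [l.IsCountablyGenerated]
    {T : ℝ} {Ω : ι → Type*} [∀ i, MeasurableSpace (Ω i)] (P : ∀ i, Measure (Ω i))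
    [∀ i, IsProbabilityMeasure (P i)] (Φ : ∀ i, Ω i → SkorokhodSpace T)
    (hΦ : ∀ i, Measurable (Φ i)) (μ : SkorokhodSpace T)
    (h : ∀ (f : C(I, ℝ)) (ε : ℝ), 0 < ε →
      Tendsto (fun i => P i {ω | ¬ ∀ t, |Φ i ω t f - μ t f| < ε}) l (𝓝 0)) :
    TendstoInDistribution Φ l (fun _ : Unit => μ) P (Measure.dirac ()) where
  forall_aemeasurable i := (hΦ i).aemeasurable
  aemeasurable_limit := aemeasurable_const
  tendsto := by
    rcases l.eq_or_neBot with rfl | hl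
    · exact tendsto_bot
    refine tendsto_of_forall_isOpen_le_liminf' fun G hG => ?_
    simp only [ProbabilityMeasure.coe_mk]
    rw [Measure.map_const, measure_univ, one_smul]
    by_cases hμ : μ ∈ G
    · refine prob_le_one.trans (le_of_eq (Tendsto.liminf_eq ?_).symm)
      obtain ⟨A, ε, hε, hA⟩ := hG μ hμ
      have hsum : Tendsto (fun i => 1 - ∑ f ∈ A, P i {ω | ¬ ∀ t, |Φ i ω t f - μ t f| < ε}) l
          (𝓝 1) := by
        have h1 := tendsto_finsetSum (a := fun _ => (0 : ENNReal)) A fun f _ => h f ε hε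
        have h2 := ENNReal.Tendsto.sub (tendsto_const_nhds (x := (1 : ENNReal)) (f := l)) h1
          (Or.inl ENNReal.one_ne_top)
        simpa using h2
      refine tendsto_of_tendsto_of_tendsto_of_le_of_le hsum tendsto_const_nhds (fun i => ?_)
        (fun i => ?_)
      · change 1 - _ ≤ (P i).map (Φ i) G
        rw [Measure.map_apply (hΦ i) hG.measurableSet, tsub_le_iff_right]
        have hcov : (univ : Set (Ω i)) ⊆ Φ i ⁻¹' G ∪
            ⋃ f ∈ A, {ω | ¬ ∀ t, |Φ i ω t f - μ t f| < ε} := by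
          intro ω _
          by_cases hω : ∀ f ∈ A, ∀ t, |Φ i ω t f - μ t f| < ε
          · exact Or.inl (hA ⟨OrderIso.refl _, fun t => by simpa using hε, hω⟩)
          · push Not at hω
            obtain ⟨f, hf, t, ht⟩ := hω
            exact Or.inr (mem_biUnion hf (fun hall => absurd (hall t) (not_lt.2 ht)))
        calc (1 : ENNReal) = P i univ := measure_univ.symm
          _ ≤ _ := measure_mono hcov
          _ ≤ _ := measure_union_le _ _
          _ ≤ _ := by gcongr; exact measure_biUnion_finset_le _ _
      · change (P i).map (Φ i) G ≤ 1
        have := Measure.isProbabilityMeasure_map (μ := P i) (hΦ i).aemeasurable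
        exact prob_le_one
    · rw [Measure.dirac_apply' _ hG.measurableSet, indicator_of_notMem hμ]
      exact zero_le

end SkorokhodSpace

/-! ### Martingales in continuous time -/

section Martingale

variable {Ω : Type*} {m : MeasurableSpace Ω} {P : Measure Ω} [IsProbabilityMeasure P]
  {ℱ : Filtration ℝ≥0 m} {M : ℝ≥0 → Ω → ℝ}

lemma integral_mul_martingale_sub_eq_zero (hM : Martingale M ℱ P) {s t : ℝ≥0} (hst : s ≤ t)
    {Z : Ω → ℝ} (hZ : StronglyMeasurable[ℱ s] Z) {C : ℝ} (hC : ∀ ω, |Z ω| ≤ C) :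
    ∫ ω, Z ω * (M t ω - M s ω) ∂P = 0 := by
  have hint : Integrable (M t - M s) P := (hM.integrable t).sub (hM.integrable s)
  have hint2 : Integrable (Z * (M t - M s)) P :=
    hint.bdd_mul (hZ.mono (ℱ.le s)).aestronglyMeasurable (ae_of_all _ hC)
  have h0 : P[M t - M s | ℱ s] =ᵐ[P] 0 := by
    have h1 := condExp_sub (hM.integrable t) (hM.integrable s) (ℱ s)
    have h2 := hM.condExp_ae_eq hst
    have h3 := hM.condExp_ae_eq (le_refl s)
    filter_upwards [h1, h2, h3] with ω h1 h2 h3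
    rw [h1, Pi.sub_apply, h2, h3, sub_self, Pi.zero_apply]
  have h1 := condExp_mul_of_stronglyMeasurable_left hZ hint2 hint
  calc ∫ ω, Z ω * (M t ω - M s ω) ∂P = ∫ ω, (Z * (M t - M s)) ω ∂P := rfl
    _ = ∫ ω, (P[Z * (M t - M s) | ℱ s]) ω ∂P := (integral_condExp (ℱ.le s)).symm
    _ = ∫ _, (0 : ℝ) ∂P := by
      refine integral_congr_ae ?_
      filter_upwards [h1, h0] with ω h1 h0
      rw [h1, Pi.mul_apply, h0, Pi.zero_apply, mul_zero]
    _ = 0 := by simp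

/-- The martingale observed along the grid `0, h, 2h, …` and started at zero. -/
lemma martingale_grid (hM : Martingale M ℱ P) (h : ℝ≥0) :
    Martingale (fun (k : ℕ) ω => M (k * h) ω - M 0 ω)
      (⟨fun k => ℱ (k * h), fun _ _ hij => ℱ.mono (by gcongr), fun _ => ℱ.le _⟩ :
        Filtration ℕ m) P := by
  refine ⟨fun k => (hM.stronglyAdapted _).sub
    ((hM.stronglyAdapted 0).mono (ℱ.mono (zero_le))), fun i j hij => ?_⟩
  have h1 := condExp_sub (hM.integrable (j * h)) (hM.integrable 0) (ℱ (i * h))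
  have h2 := hM.condExp_ae_eq (show (i : ℝ≥0) * h ≤ j * h by gcongr)
  have h3 := condExp_of_stronglyMeasurable (ℱ.le (i * h))
    ((hM.stronglyAdapted 0).mono (ℱ.mono (zero_le : (0 : ℝ≥0) ≤ i * h))) (hM.integrable 0)
  filter_upwards [h1, h2] with ω h1 h2
  refine h1.trans ?_
  rw [Pi.sub_apply, h2, h3]

lemma measure_grid_le (hM : Martingale M ℱ P) (h : ℝ≥0) (n : ℕ) {ε : ℝ≥0} (hε : 0 < ε) :
    P {ω | ∃ k ≤ n, (ε : ℝ) ≤ |M (k * h) ω - M 0 ω|} ≤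
      ENNReal.ofReal (∫ ω, |M (n * h) ω - M 0 ω| ∂P) / ε := by
  have hN := martingale_grid hM h
  have hsub := hN.submartingale.sup hN.neg.submartingale
  have h1 := maximal_ineq hsub (fun k ω => by
    change 0 ≤ |M (k * h) ω - M 0 ω|
    exact abs_nonneg _) (ε := ε) n
  have hε' : (ε : ENNReal) ≠ 0 := by simpa using hε.ne'
  rw [ENNReal.le_div_iff_mul_le (Or.inl hε') (Or.inl ENNReal.coe_ne_top), mul_comm]
  refine le_trans (mul_le_mul_right (measure_mono ?_) _) (h1.trans (ENNReal.ofReal_le_ofReal ?_))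
  · rintro ω ⟨k, hk, hω⟩
    rw [mem_ofPred_eq]
    exact le_trans hω (Finset.le_sup' (fun k : ℕ => |M (k * h) ω - M 0 ω|)
      (Finset.mem_range.2 (Nat.lt_succ_of_le hk)))
  · exact setIntegral_le_integral (hN.integrable n).abs (ae_of_all _ fun ω => abs_nonneg _)

/-- Doob's maximal inequality for a right-continuous martingale. -/
lemma measure_exists_lt_abs_sub_le (hM : Martingale M ℱ P)
    (hrc : ∀ ω (t : ℝ), ContinuousWithinAt (fun s : ℝ => M s.toNNReal ω) (Ioi t) t)
    {T : ℝ≥0} (hT : 0 < T) {ε : ℝ≥0} (hε : 0 < ε) :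
    P {ω | ∃ t ≤ T, (ε : ℝ) < |M t ω - M 0 ω|} ≤
      ENNReal.ofReal (∫ ω, |M T ω - M 0 ω| ∂P) / ε := by
  set A : ℕ → Set Ω := fun n => {ω | ∃ k ≤ n + 1,
    (ε : ℝ) ≤ |M (k * (T / (n + 1))) ω - M 0 ω|} with hA
  have hAn : ∀ n, P (A n) ≤ ENNReal.ofReal (∫ ω, |M T ω - M 0 ω| ∂P) / ε := fun n => by
    have h1 := measure_grid_le hM (T / (n + 1)) (n + 1) hε
    have h2 : ((n + 1 : ℕ) : ℝ≥0) * (T / (n + 1)) = T := by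
      push_cast; field_simp
    rwa [h2] at h1
  have hsub : {ω | ∃ t ≤ T, (ε : ℝ) < |M t ω - M 0 ω|} ⊆ ⋃ m : ℕ, ⋂ n ≥ m, A n := by
    rintro ω ⟨t, ht, hω⟩
    rw [mem_iUnion]
    suffices ∀ᶠ n in atTop, ω ∈ A n by
      obtain ⟨m, hm⟩ := eventually_atTop.1 this
      exact ⟨m, mem_iInter₂.2 hm⟩
    rcases ht.eq_or_lt with rfl | ht
    · refine Eventually.of_forall fun n => ⟨n + 1, le_rfl, ?_⟩
      have h2 : ((n + 1 : ℕ) : ℝ≥0) * (t / (n + 1)) = t := by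
        push_cast; field_simp
      rw [h2]
      exact hω.le
    · have hT' : (0 : ℝ) < T := hT
      have h1 : Tendsto (fun n : ℕ => (T : ℝ) * (((⌊((n : ℝ) + 1) * (t / T : ℝ)⌋ : ℝ) + 1) /
          ((n : ℝ) + 1))) atTop (𝓝[>] (t : ℝ)) := by
        have h2 := tendsto_floor_add_one_div (t / T : ℝ)
        rw [tendsto_nhdsWithin_iff] at h2 ⊢
        have h3 : (T : ℝ) * (t / T : ℝ) = t := by field_simp
        refine ⟨?_, ?_⟩
        · have := h2.1.const_mul (T : ℝ)
          rwa [h3] at this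
        · filter_upwards [h2.2] with n hn
          have := mul_lt_mul_of_pos_left hn hT'
          rwa [h3] at this
      have h2 := (hrc ω t).tendsto.comp h1
      have h3 : Tendsto (fun n : ℕ => |M ((T : ℝ) * (((⌊((n : ℝ) + 1) * (t / T : ℝ)⌋ : ℝ) + 1) /
          ((n : ℝ) + 1))).toNNReal ω - M 0 ω|) atTop (𝓝 |M t ω - M 0 ω|) := by
        have := (h2.sub_const (M 0 ω)).abs
        simpa only [Real.toNNReal_coe, Function.comp_def] using this
      filter_upwards [h3.eventually (lt_mem_nhds hω)] with n hn
      have hf0 : (0 : ℤ) ≤ ⌊((n : ℝ) + 1) * (t / T : ℝ)⌋ := Int.floor_nonneg.2 (by positivity)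
      have hfl : ⌊((n : ℝ) + 1) * (t / T : ℝ)⌋ < ((n + 1 : ℕ) : ℤ) := by
        rw [Int.floor_lt]
        push_cast
        have : (t / T : ℝ) < 1 := by rw [div_lt_one hT']; exact ht
        nlinarith [n.cast_nonneg (α := ℝ)]
      obtain ⟨k, hk⟩ := Int.eq_ofNat_of_zero_le hf0
      refine ⟨k + 1, by omega, ?_⟩
      rw [hk] at hn
      have e : (((k + 1 : ℕ) : ℝ≥0) * (T / (n + 1))) =
          ((T : ℝ) * ((((k : ℤ) : ℝ) + 1) / ((n : ℝ) + 1))).toNNReal := by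
        rw [← NNReal.coe_inj, Real.coe_toNNReal _ (by positivity)]
        push_cast
        ring
      rw [e]
      exact hn.le
  refine (measure_mono hsub).trans ?_
  have hmono : Monotone fun m : ℕ => ⋂ n ≥ m, A n := fun m m' hmm =>
    biInter_mono (fun n (hn : m' ≤ n) => hmm.trans hn) fun _ _ => le_rfl
  refine le_of_tendsto' (tendsto_measure_iUnion_atTop hmono) fun m => ?_
  exact (measure_mono (biInter_subset_of_mem (le_refl m))).trans (hAn m)

/-- The second moment of a bounded martingale along a grid, from bounds on its increments. -/
lemma integral_sq_grid_le (hM : Martingale M ℱ P) {C : ℝ≥0 → ℝ} (hC : ∀ t ω, |M t ω| ≤ C t)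
    (h : ℝ≥0) {v : ℝ} (hv : ∀ s : ℝ≥0, ∫ ω, (M (s + h) ω - M s ω) ^ 2 ∂P ≤ v) (n : ℕ) :
    ∫ ω, (M (n * h) ω - M 0 ω) ^ 2 ∂P ≤ n * v := by
  have hmeas : ∀ s t : ℝ≥0, AEStronglyMeasurable (fun ω => M t ω - M s ω) P := fun s t =>
    ((hM.integrable t).sub (hM.integrable s)).aestronglyMeasurable
  have hbd : ∀ s t ω, |M t ω - M s ω| ≤ C t + C s := fun s t ω =>
    (abs_sub _ _).trans (add_le_add (hC t ω) (hC s ω))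
  have hint : ∀ s t u r : ℝ≥0,
      Integrable (fun ω => (M t ω - M s ω) * (M u ω - M r ω)) P := fun s t u r =>
    ((hM.integrable u).sub (hM.integrable r)).bdd_mul (hmeas s t) (ae_of_all _ (hbd s t))
  induction n with
  | zero => simp
  | succ n ih =>
    have e : ((n + 1 : ℕ) : ℝ≥0) * h = n * h + h := by push_cast; ring
    have hcross := integral_mul_martingale_sub_eq_zero hM
      (show (n : ℝ≥0) * h ≤ n * h + h from le_self_add)
      (Z := fun ω => M (n * h) ω - M 0 ω) ((hM.stronglyAdapted _).sub
        ((hM.stronglyAdapted 0).mono (ℱ.mono zero_le))) (hbd _ _)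
    calc ∫ ω, (M ((n + 1 : ℕ) * h) ω - M 0 ω) ^ 2 ∂P
        = ∫ ω, ((M (n * h) ω - M 0 ω) * (M (n * h) ω - M 0 ω) +
            (M (n * h + h) ω - M (n * h) ω) * (M (n * h + h) ω - M (n * h) ω)) +
            2 * ((M (n * h) ω - M 0 ω) * (M (n * h + h) ω - M (n * h) ω)) ∂P := by
          rw [e]; congr 1; ext ω; ring
      _ = (∫ ω, (M (n * h) ω - M 0 ω) ^ 2 ∂P) +
            (∫ ω, (M (n * h + h) ω - M (n * h) ω) ^ 2 ∂P) := by
          have h12 : Integrable (fun ω =>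
              (M (n * h) ω - M 0 ω) * (M (n * h) ω - M 0 ω) +
              (M (n * h + h) ω - M (n * h) ω) * (M (n * h + h) ω - M (n * h) ω)) P :=
            (hint _ _ _ _).add (hint _ _ _ _)
          rw [integral_add h12 ((hint _ _ _ _).const_mul 2),
            integral_add (hint _ _ _ _) (hint _ _ _ _), integral_const_mul, hcross]
          simp only [pow_two]; ring
      _ ≤ n * v + v := add_le_add ih (hv _)
      _ = _ := by push_cast; ring

end Martingale

/-! ### The generator of the urn model -/

variable {N : ℕ}

/-- The total number of balls. -/
def total (x : Config N) : ℕ := ∑ i, x i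

lemma move_self (x : Config N) (i : Fin N) : move x i i = x := by ext l; simp [move]

lemma move_add_single {x : Config N} {i : Fin N} (j : Fin N) (hi : x i ≠ 0) :
    move x i j + Pi.single i 1 = x + Pi.single j 1 := by
  by_cases hij : i = j
  · rw [hij, move_self]
  · ext l
    simp only [move, hij, if_false, Pi.add_apply]
    by_cases hl : l = i
    · subst hl
      simp [hij]
      omega
    · by_cases hl' : l = j
      · subst hl'; simp [hl]
      · simp [hl, hl']

lemma sum_move_mul {x : Config N} {i : Fin N} (j : Fin N) (hi : x i ≠ 0) (g : Fin N → ℝ) :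
    ∑ l, (move x i j l : ℝ) * g l = (∑ l, (x l : ℝ) * g l) + (g j - g i) := by
  have h1 : ∀ l, ((move x i j l : ℕ) : ℝ) + (Pi.single i 1 : Fin N → ℝ) l =
      (x l : ℝ) + (Pi.single j 1 : Fin N → ℝ) l := fun l => by
    have h2 := congrArg (Nat.cast (R := ℝ)) (congrFun (move_add_single j hi) l)
    simpa [Pi.single_apply] using h2
  have h2 : ∑ l, ((move x i j l : ℝ) + (Pi.single i 1 : Fin N → ℝ) l) * g l =
      ∑ l, ((x l : ℝ) + (Pi.single j 1 : Fin N → ℝ) l) * g l := by simp only [h1]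
  simp only [add_mul, Finset.sum_add_distrib, Pi.single_apply, ite_mul, one_mul, zero_mul,
    Finset.sum_ite_eq', Finset.mem_univ, if_true] at h2
  linarith

lemma total_move {x : Config N} {i : Fin N} (j : Fin N) (hi : x i ≠ 0) :
    total (move x i j) = total x := by
  have h := sum_move_mul j hi fun _ => 1
  simp only [mul_one, sub_self, add_zero] at h
  exact_mod_cast h

/-- The restriction of a function to the configurations of at most `K` balls. -/
def truncate (K : ℕ) (g : Config N → ℝ) (x : Config N) : ℝ := if total x ≤ K then g x else 0

lemma truncate_of_le {K : ℕ} (g : Config N → ℝ) {x : Config N} (h : total x ≤ K) :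
    truncate K g x = g x := if_pos h

lemma truncate_mul_truncate (K : ℕ) (g g' : Config N → ℝ) :
    truncate K g * truncate K g' = truncate K (g * g') := by
  ext x
  by_cases h : total x ≤ K <;> simp [truncate, h]

lemma finite_support_truncate (K : ℕ) (g : Config N → ℝ) : (truncate K g).support.Finite := by
  refine (Set.Finite.pi' (t := fun _ : Fin N => Iic K) fun _ => finite_Iic K).subset
    fun x hx i => ?_
  have h : total x ≤ K := by
    by_contra h
    exact hx (if_neg h)
  exact (Finset.single_le_sum (fun _ _ => Nat.zero_le _) (Finset.mem_univ i)).trans h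

lemma exists_abs_truncate_le (K : ℕ) (g : Config N → ℝ) :
    ∃ C, 0 ≤ C ∧ ∀ x, |truncate K g x| ≤ C := by
  obtain ⟨C, hC⟩ := (((finite_support_truncate K g).image (fun x => |truncate K g x|))).bddAbove
  refine ⟨max C 0, le_max_right _ _, fun x => ?_⟩
  by_cases hx : truncate K g x = 0
  · simp [hx]
  · exact (hC (mem_image_of_mem _ hx)).trans (le_max_left _ _)

/-- Moves conserve the number of balls, so that the generator commutes with truncation. -/
lemma generator_truncate (lam : C(I × I, ℝ)) (K : ℕ) (g : Config N → ℝ) :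
    generator lam N (truncate K g) = truncate K (generator lam N g) := by
  ext x
  by_cases h : total x ≤ K
  · rw [truncate_of_le _ h]
    unfold generator
    refine Finset.sum_congr rfl fun i _ => Finset.sum_congr rfl fun j _ => ?_
    by_cases hi : x i = 0
    · simp [hi]
    · rw [truncate_of_le _ h, truncate_of_le _ ((total_move j hi).trans_le h)]
  · rw [truncate, if_neg h]
    unfold generator
    refine Finset.sum_eq_zero fun i _ => Finset.sum_eq_zero fun j _ => ?_
    by_cases hi : x i = 0
    · simp [hi]
    · rw [truncate, truncate, if_neg h, if_neg (by rwa [total_move j hi]), sub_zero, mul_zero]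

/-- The carré du champ `ℒ_N f² - 2 f ℒ_N f`. -/
def carreDuChamp (lam : C(I × I, ℝ)) (N : ℕ) (f : Config N → ℝ) (x : Config N) : ℝ :=
  ∑ i, ∑ j, (x i : ℝ) * lam (loc i, loc j) / N * (f (move x i j) - f x) ^ 2

lemma generator_mul_self_sub (lam : C(I × I, ℝ)) (f : Config N → ℝ) (x : Config N) :
    generator lam N (f * f) x - 2 * f x * generator lam N f x = carreDuChamp lam N f x := by
  simp only [generator, carreDuChamp, Finset.mul_sum, ← Finset.sum_sub_distrib, Pi.mul_apply]
  refine Finset.sum_congr rfl fun i _ => Finset.sum_congr rfl fun j _ => ?_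
  ring

lemma carreDuChamp_truncate (lam : C(I × I, ℝ)) (K : ℕ) (g : Config N → ℝ) :
    carreDuChamp lam N (truncate K g) = truncate K (carreDuChamp lam N g) := by
  ext x
  rw [← generator_mul_self_sub, truncate_mul_truncate, generator_truncate, generator_truncate]
  by_cases h : total x ≤ K
  · simp only [truncate_of_le _ h, generator_mul_self_sub]
  · simp [truncate, h]

/-! ### The Dynkin martingales -/

lemma abs_integral_le_of_abs_le {Ω : Type*} (X : ℝ≥0 → Ω → Config N) {g : Config N → ℝ} {C : ℝ}
    (hg : ∀ x, |g x| ≤ C) (s t : ℝ≥0) (hst : s ≤ t) (ω : Ω) :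
    |∫ u in (s : ℝ)..t, g (X u.toNNReal ω)| ≤ C * (t - s) := by
  have h1 := intervalIntegral.norm_integral_le_of_norm_le_const (a := (s : ℝ)) (b := t)
    (f := fun u => g (X u.toNNReal ω)) (C := C) fun u _ => hg _
  rwa [abs_of_nonneg (sub_nonneg.2 (NNReal.coe_le_coe.2 hst))] at h1

section Dynkin

variable {lam : C(I × I, ℝ)} {Ω : Type*} [MeasurableSpace Ω] {P : Measure Ω}
  {X : ℝ≥0 → Ω → Config N}

/-- The process `f(X_t) - ∫₀ᵗ ℒ_N f(X_s) ds`. -/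
def dynkin (lam : C(I × I, ℝ)) (X : ℝ≥0 → Ω → Config N) (f : Config N → ℝ) (t : ℝ≥0) (ω : Ω) : ℝ :=
  f (X t ω) - ∫ s in (0 : ℝ)..t, generator lam N f (X s.toNNReal ω)

namespace IsUrnProcess

lemma measurable_apply (h : IsUrnProcess lam N P X) (g : Config N → ℝ) (t : ℝ≥0) :
    Measurable fun ω => g (X t ω) :=
  (measurable_of_countable g).comp (h.measurable t)

lemma rightContinuous (h : IsUrnProcess lam N P X) (g : Config N → ℝ) (ω : Ω) (t : ℝ) :
    ContinuousWithinAt (fun s : ℝ => g (X s.toNNReal ω)) (Ioi t) t :=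
  ((h.cadlag ω).comp_continuous (g := g) continuous_of_discreteTopology).rightContinuous_comp
    continuous_real_toNNReal (fun _ _ => Real.toNNReal_mono) t

lemma measurable_uncurry (h : IsUrnProcess lam N P X) (g : Config N → ℝ) :
    Measurable (fun p : ℝ × Ω => g (X p.1.toNNReal p.2)) :=
  measurable_uncurry_of_rightContinuous (F := fun s ω => g (X s.toNNReal ω))
    (fun _ => (measurable_of_countable g).comp (h.measurable _)) (h.rightContinuous g)

lemma intervalIntegrable (h : IsUrnProcess lam N P X) {g : Config N → ℝ} {C : ℝ}
    (hg : ∀ x, |g x| ≤ C) (ω : Ω) (a b : ℝ) :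
    IntervalIntegrable (fun s : ℝ => g (X s.toNNReal ω)) volume a b :=
  (intervalIntegrable_const (c := C)).mono_fun
    (measurable_of_rightContinuous (h.rightContinuous g ω)).aestronglyMeasurable
    (ae_of_all _ fun s => by simpa using (hg _).trans (le_abs_self C))

lemma dynkin_sub (h : IsUrnProcess lam N P X) {f : Config N → ℝ} {C : ℝ}
    (hf : ∀ x, |generator lam N f x| ≤ C) (s t : ℝ≥0) (ω : Ω) :
    dynkin lam X f t ω - dynkin lam X f s ω = f (X t ω) - f (X s ω) -
      ∫ u in (s : ℝ)..t, generator lam N f (X u.toNNReal ω) := by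
  have h1 := intervalIntegral.integral_interval_sub_left (h.intervalIntegrable hf ω 0 t)
    (h.intervalIntegrable hf ω 0 s)
  rw [← h1, dynkin, dynkin]
  ring

lemma rightContinuous_dynkin (h : IsUrnProcess lam N P X) {f : Config N → ℝ} {C : ℝ}
    (hf : ∀ x, |generator lam N f x| ≤ C) (ω : Ω) (t : ℝ) :
    ContinuousWithinAt (fun s : ℝ => dynkin lam X f s.toNNReal ω) (Ioi t) t := by
  have h1 : Continuous fun s : ℝ =>
      ∫ u in (0 : ℝ)..s, generator lam N f (X u.toNNReal ω) :=
    intervalIntegral.continuous_primitive (fun a b => h.intervalIntegrable hf ω a b) 0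
  have h2 : Continuous fun s : ℝ =>
      ∫ u in (0 : ℝ)..(s.toNNReal : ℝ), generator lam N f (X u.toNNReal ω) :=
    h1.comp (NNReal.continuous_coe.comp continuous_real_toNNReal)
  exact (h.rightContinuous f ω t).sub h2.continuousWithinAt

variable [IsProbabilityMeasure P]

/-- The second moment of the increments of `f(X)`: write `(f(X_t) - f(X_s))²` as the difference of
the increment of `f(X)²` and `2 f(X_s)` times the increment of `f(X)`, and replace both increments
by their compensators. -/
lemma integral_sq_sub_eq (h : IsUrnProcess lam N P X) (K : ℕ) (g : Config N → ℝ) {s t : ℝ≥0}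
    (hst : s ≤ t) :
    IntervalIntegrable (fun u : ℝ => ∫ ω, (generator lam N (truncate K g * truncate K g)
        (X u.toNNReal ω) - 2 * truncate K g (X s ω) *
          generator lam N (truncate K g) (X u.toNNReal ω)) ∂P) volume s t ∧
    ∫ ω, (truncate K g (X t ω) - truncate K g (X s ω)) ^ 2 ∂P =
      ∫ u in (s : ℝ)..t, ∫ ω, (generator lam N (truncate K g * truncate K g) (X u.toNNReal ω) -
        2 * truncate K g (X s ω) * generator lam N (truncate K g) (X u.toNNReal ω)) ∂P := by
  set f := truncate K g with hf
  have hff : f * f = truncate K (g * g) := truncate_mul_truncate K g g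
  obtain ⟨B, hB0, hB⟩ := exists_abs_truncate_le K g
  obtain ⟨L, hL0, hL⟩ := exists_abs_truncate_le K (generator lam N g)
  obtain ⟨L2, hL20, hL2⟩ := exists_abs_truncate_le K (generator lam N (g * g))
  rw [← generator_truncate, ← hf] at hL
  rw [← generator_truncate, ← hff] at hL2
  set Ψ : ℝ → Ω → ℝ := fun u ω => generator lam N (f * f) (X u.toNNReal ω) -
    2 * f (X s ω) * generator lam N f (X u.toNNReal ω) with hΨ
  have hmeas : Measurable (Function.uncurry Ψ) :=
    (h.measurable_uncurry _).sub (((measurable_const.mul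
      (((measurable_of_countable f).comp (h.measurable s)).comp measurable_snd))).mul
      (h.measurable_uncurry _))
  have hbd : ∀ p, ‖Function.uncurry Ψ p‖ ≤ L2 + 2 * B * L := by
    rintro ⟨u, ω⟩
    refine (abs_sub _ _).trans (add_le_add (hL2 _) ?_)
    rw [abs_mul, abs_mul, abs_two]
    gcongr
    · exact hB _
    · exact hL _
  have hfin : IsFiniteMeasure (volume.restrict (uIoc (s : ℝ) t)) :=
    isFiniteMeasure_restrict.2 (by simp [uIoc])
  have hint : Integrable (Function.uncurry Ψ)
      ((volume.restrict (uIoc (s : ℝ) t)).prod P) :=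
    Integrable.of_bound hmeas.aestronglyMeasurable _ (ae_of_all _ hbd)
  refine ⟨?_, ?_⟩
  · rw [intervalIntegrable_iff]
    exact hint.integral_prod_left
  · rw [intervalIntegral_integral_swap hint]
    have hM := h.martingale f (finite_support_truncate K g)
    have hM2 := h.martingale (f * f) (hff ▸ finite_support_truncate K (g * g))
    have hZ : StronglyMeasurable[Filtration.natural X
        (fun t => (h.measurable t).stronglyMeasurable) s] (fun ω => f (X s ω)) :=
      (continuous_of_discreteTopology (f := f)).comp_stronglyMeasurable
        (Filtration.stronglyAdapted_natural _ s)
    have hZ1 : StronglyMeasurable[Filtration.natural X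
        (fun t => (h.measurable t).stronglyMeasurable) s] (fun _ : Ω => (1 : ℝ)) :=
      stronglyMeasurable_const
    have e1 := integral_mul_martingale_sub_eq_zero hM2 hst hZ1 (C := 1) (by simp)
    have e2 := integral_mul_martingale_sub_eq_zero hM hst hZ (fun ω => hB _)
    change ∫ ω, 1 * (dynkin lam X (f * f) t ω - dynkin lam X (f * f) s ω) ∂P = 0 at e1
    change ∫ ω, f (X s ω) * (dynkin lam X f t ω - dynkin lam X f s ω) ∂P = 0 at e2
    have i1 : Integrable (fun ω => 1 * (dynkin lam X (f * f) t ω - dynkin lam X (f * f) s ω)) P :=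
      ((hM2.integrable t).sub (hM2.integrable s)).const_mul 1
    have i2 : Integrable (fun ω => f (X s ω) * (dynkin lam X f t ω - dynkin lam X f s ω)) P :=
      ((hM.integrable t).sub (hM.integrable s)).bdd_mul
        ((measurable_of_countable f).comp (h.measurable s)).aestronglyMeasurable
        (ae_of_all _ fun ω => hB _)
    have i3 : Integrable (fun ω => ∫ u in (s : ℝ)..t, Ψ u ω) P := by
      have := hint.integral_prod_right
      simpa only [intervalIntegral.integral_of_le (NNReal.coe_le_coe.2 hst),
        uIoc_of_le (NNReal.coe_le_coe.2 hst), Function.uncurry_apply_pair] using this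
    have hpath : ∀ ω, (f (X t ω) - f (X s ω)) ^ 2 =
        (1 * (dynkin lam X (f * f) t ω - dynkin lam X (f * f) s ω) -
          2 * (f (X s ω) * (dynkin lam X f t ω - dynkin lam X f s ω))) +
          ∫ u in (s : ℝ)..t, Ψ u ω := fun ω => by
      have e : ∫ u in (s : ℝ)..t, Ψ u ω =
          (∫ u in (s : ℝ)..t, generator lam N (f * f) (X u.toNNReal ω)) -
          2 * f (X s ω) * ∫ u in (s : ℝ)..t, generator lam N f (X u.toNNReal ω) := by
        rw [hΨ, intervalIntegral.integral_sub (h.intervalIntegrable hL2 ω _ _)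
          ((h.intervalIntegrable hL ω _ _).const_mul _), intervalIntegral.integral_const_mul]
      rw [e, h.dynkin_sub hL2, h.dynkin_sub hL, Pi.mul_apply, Pi.mul_apply]
      ring
    have i12 : Integrable (fun ω => 1 * (dynkin lam X (f * f) t ω - dynkin lam X (f * f) s ω) -
        2 * (f (X s ω) * (dynkin lam X f t ω - dynkin lam X f s ω))) P := i1.sub (i2.const_mul 2)
    rw [integral_congr_ae (ae_of_all _ hpath), integral_add i12 i3,
      integral_sub i1 (i2.const_mul 2), e1, integral_const_mul, e2]
    simp

/-- The quadratic fluctuations of a Dynkin martingale are controlled by the carré du champ. The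
bound is summed over a grid; the errors from freezing `f` at grid times and the squares of the
compensators vanish as the mesh tends to zero. -/
lemma integral_sq_dynkin_sub_le (h : IsUrnProcess lam N P X) (K : ℕ) (g : Config N → ℝ) {γ : ℝ}
    (hγ : ∀ x, carreDuChamp lam N (truncate K g) x ≤ γ) (T : ℝ≥0) :
    ∫ ω, (dynkin lam X (truncate K g) T ω - dynkin lam X (truncate K g) 0 ω) ^ 2 ∂P ≤
      2 * T * γ := by
  obtain ⟨B, hB0, hB⟩ := exists_abs_truncate_le K g
  obtain ⟨L, hL0, hL⟩ := exists_abs_truncate_le K (generator lam N g)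
  obtain ⟨L2, hL20, hL2⟩ := exists_abs_truncate_le K (generator lam N (g * g))
  rw [← generator_truncate] at hL
  rw [← generator_truncate, ← truncate_mul_truncate] at hL2
  have hmf := h.measurable_apply (truncate K g)
  have hmL := h.measurable_apply (generator lam N (truncate K g))
  have hmL2 := h.measurable_apply (generator lam N (truncate K g * truncate K g))
  have hE := fun {s t : ℝ≥0} (hst : s ≤ t) => h.integral_sq_sub_eq K g hst
  set f := truncate K g with hf
  set C₁ := L2 + 2 * B * L with hC₁
  have hC₁0 : 0 ≤ C₁ := by positivity
  have hbdd : ∀ s u : ℝ≥0, ∀ ω, |generator lam N (f * f) (X u ω) -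
      2 * f (X s ω) * generator lam N f (X u ω)| ≤ C₁ := fun s u ω => by
    refine (abs_sub _ _).trans (add_le_add (hL2 _) ?_)
    rw [abs_mul, abs_mul, abs_two]
    gcongr
    · exact hB _
    · exact hL _
  have hsqint : ∀ s t : ℝ≥0, Integrable (fun ω => (f (X t ω) - f (X s ω)) ^ 2) P := fun s t =>
    Integrable.of_bound (((hmf t).sub (hmf s)).pow_const 2).aestronglyMeasurable ((2 * B) ^ 2)
      (ae_of_all _ fun ω => by
        rw [norm_pow, Real.norm_eq_abs]
        refine pow_le_pow_left₀ (abs_nonneg _) ((abs_sub _ _).trans ?_) 2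
        linarith [hB (X t ω), hB (X s ω)])
  -- a rough bound, linear in the length of the time interval
  have hrough : ∀ s t : ℝ≥0, s ≤ t → ∫ ω, (f (X t ω) - f (X s ω)) ^ 2 ∂P ≤ C₁ * (t - s) := by
    intro s t hst
    have hst' : (s : ℝ) ≤ t := hst
    rw [(hE hst).2]
    refine (le_abs_self _).trans ?_
    have := intervalIntegral.norm_integral_le_of_norm_le_const (a := (s : ℝ)) (b := t) (C := C₁)
      (f := fun u : ℝ => ∫ ω, (generator lam N (f * f) (X u.toNNReal ω) -
        2 * f (X s ω) * generator lam N f (X u.toNNReal ω)) ∂P) fun u _ => by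
          have := norm_integral_le_of_norm_le_const (μ := P) (C := C₁)
            (f := fun ω => generator lam N (f * f) (X u.toNNReal ω) -
              2 * f (X s ω) * generator lam N f (X u.toNNReal ω))
            (ae_of_all _ fun ω => hbdd s u.toNNReal ω)
          simpa using this
    rwa [abs_of_nonneg (sub_nonneg.2 hst')] at this
  -- the sharp bound: the rough one controls the freezing of `f` at the left end point
  have hsharp : ∀ δ : ℝ, 0 < δ → ∀ s t : ℝ≥0, s ≤ t →
      ∫ ω, (f (X t ω) - f (X s ω)) ^ 2 ∂P ≤
        (γ + 2 * L * (δ + C₁ * (t - s) / δ)) * (t - s) := by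
    intro δ hδ s t hst
    have hst' : (s : ℝ) ≤ t := hst
    rw [(hE hst).2]
    have hle : ∀ u ∈ Icc (s : ℝ) t, ∫ ω, (generator lam N (f * f) (X u.toNNReal ω) -
        2 * f (X s ω) * generator lam N f (X u.toNNReal ω)) ∂P ≤
        γ + 2 * L * (δ + C₁ * (t - s) / δ) := by
      intro u hu
      have hu0 : 0 ≤ u := s.2.trans hu.1
      have hsu : s ≤ u.toNNReal := by rw [← NNReal.coe_le_coe, Real.coe_toNNReal u hu0]; exact hu.1
      have hi : Integrable (fun ω => γ + 2 * L *
          (δ + (f (X u.toNNReal ω) - f (X s ω)) ^ 2 / δ)) P :=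
        (integrable_const _).add (((integrable_const _).add
          ((hsqint _ _).div_const δ)).const_mul _)
      calc ∫ ω, (generator lam N (f * f) (X u.toNNReal ω) -
            2 * f (X s ω) * generator lam N f (X u.toNNReal ω)) ∂P
          ≤ ∫ ω, (γ + 2 * L * (δ + (f (X u.toNNReal ω) - f (X s ω)) ^ 2 / δ)) ∂P := by
            refine integral_mono (Integrable.of_bound ((hmL2 _).sub
              ((measurable_const.mul (hmf s)).mul (hmL _))).aestronglyMeasurable C₁
              (ae_of_all _ (hbdd s _))) hi fun ω => ?_
            have e1 := generator_mul_self_sub lam f (X u.toNNReal ω)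
            have e2 := hγ (X u.toNNReal ω)
            have e3 : 2 * (f (X u.toNNReal ω) - f (X s ω)) *
                generator lam N f (X u.toNNReal ω) ≤
                2 * L * (δ + (f (X u.toNNReal ω) - f (X s ω)) ^ 2 / δ) := by
              -- the elementary bound `|a| ≤ δ + a² / δ` turns second moments into first ones
              have e4 : |f (X u.toNNReal ω) - f (X s ω)| ≤
                  δ + (f (X u.toNNReal ω) - f (X s ω)) ^ 2 / δ := by
                have e5 : δ + (f (X u.toNNReal ω) - f (X s ω)) ^ 2 / δ =
                    (δ ^ 2 + |f (X u.toNNReal ω) - f (X s ω)| ^ 2) / δ := by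
                  rw [sq_abs]; field_simp
                rw [e5, le_div_iff₀ hδ]
                nlinarith [sq_nonneg (δ - |f (X u.toNNReal ω) - f (X s ω)|),
                  abs_nonneg (f (X u.toNNReal ω) - f (X s ω)),
                  mul_nonneg (abs_nonneg (f (X u.toNNReal ω) - f (X s ω))) hδ.le]
              calc _ ≤ |2 * (f (X u.toNNReal ω) - f (X s ω)) *
                    generator lam N f (X u.toNNReal ω)| := le_abs_self _
                _ = 2 * |generator lam N f (X u.toNNReal ω)| *
                    |f (X u.toNNReal ω) - f (X s ω)| := by
                  rw [abs_mul, abs_mul, abs_two]; ring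
                _ ≤ _ := by
                  gcongr
                  exact hL _
            change generator lam N (f * f) (X u.toNNReal ω) -
              2 * f (X s ω) * generator lam N f (X u.toNNReal ω) ≤ _
            linarith
        _ = γ + 2 * L * (δ + (∫ ω, (f (X u.toNNReal ω) - f (X s ω)) ^ 2 ∂P) / δ) := by
            have hi' : Integrable (fun ω => δ + (f (X u.toNNReal ω) - f (X s ω)) ^ 2 / δ) P :=
              (integrable_const _).add ((hsqint _ _).div_const δ)
            rw [integral_add (integrable_const _) (hi'.const_mul _), integral_const_mul,
              integral_add (integrable_const _) ((hsqint _ _).div_const δ), integral_div]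
            simp
        _ ≤ _ := by
            gcongr
            refine (hrough _ _ hsu).trans ?_
            rw [Real.coe_toNNReal u hu0]
            gcongr
            exact hu.2
    have := intervalIntegral.integral_mono_on hst' (hE hst).1
      (intervalIntegrable_const (c := γ + 2 * L * (δ + C₁ * (t - s) / δ))) hle
    rwa [intervalIntegral.integral_const, smul_eq_mul, mul_comm ((t : ℝ) - s)] at this
  have hM := h.martingale f (finite_support_truncate K g)
  have hMb : ∀ (t : ℝ≥0) ω, |dynkin lam X f t ω| ≤ B + L * t := fun t ω => by
    refine (abs_sub _ _).trans (add_le_add (hB _) ?_)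
    have := abs_integral_le_of_abs_le X hL 0 t zero_le ω
    simpa using this
  have hgrid : ∀ δ : ℝ, 0 < δ → ∀ n : ℕ,
      ∫ ω, (dynkin lam X f T ω - dynkin lam X f 0 ω) ^ 2 ∂P ≤
        2 * T * (γ + 2 * L * (δ + C₁ * (T / (n + 1)) / δ)) + 2 * L ^ 2 * T * (T / (n + 1)) := by
    intro δ hδ n
    have h1 := integral_sq_grid_le hM hMb (T / (n + 1))
      (v := 2 * ((γ + 2 * L * (δ + C₁ * (T / (n + 1)) / δ)) * (T / (n + 1))) +
        2 * (L * (T / (n + 1))) ^ 2) (fun s => by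
        have h2 := hsharp δ hδ s (s + T / (n + 1)) le_self_add
        have h3 : ((s + T / (n + 1) : ℝ≥0) : ℝ) - s = T / (n + 1) := by push_cast; ring
        rw [h3] at h2
        change ∫ ω, (dynkin lam X f (s + T / (n + 1)) ω - dynkin lam X f s ω) ^ 2 ∂P ≤ _
        calc ∫ ω, (dynkin lam X f (s + T / (n + 1)) ω - dynkin lam X f s ω) ^ 2 ∂P
            ≤ ∫ ω, (2 * (f (X (s + T / (n + 1)) ω) - f (X s ω)) ^ 2 +
                2 * (L * (T / (n + 1))) ^ 2) ∂P := by
              refine integral_mono_of_nonneg (ae_of_all _ fun ω => sq_nonneg _)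
                (((hsqint _ _).const_mul 2).add (integrable_const _)) (ae_of_all _ fun ω => ?_)
              have h4 := abs_integral_le_of_abs_le X hL s (s + T / (n + 1)) le_self_add ω
              rw [h3] at h4
              have h5 := sq_le_sq' (abs_le.1 h4).1 (abs_le.1 h4).2
              change (dynkin lam X f (s + T / (n + 1)) ω - dynkin lam X f s ω) ^ 2 ≤ _
              rw [h.dynkin_sub hL]
              nlinarith [sq_nonneg (f (X (s + T / (n + 1)) ω) - f (X s ω) +
                ∫ u in (s : ℝ)..(s + T / (n + 1) : ℝ≥0),
                  generator lam N f (X u.toNNReal ω))]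
          _ = 2 * (∫ ω, (f (X (s + T / (n + 1)) ω) - f (X s ω)) ^ 2 ∂P) +
                2 * (L * (T / (n + 1))) ^ 2 := by
              rw [integral_add ((hsqint _ _).const_mul 2) (integrable_const _),
                integral_const_mul]
              simp
          _ ≤ _ := by linarith) (n + 1)
    have e : ((n + 1 : ℕ) : ℝ≥0) * (T / (n + 1)) = T := by push_cast; field_simp
    rw [e] at h1
    refine h1.trans (le_of_eq ?_)
    push_cast
    field_simp
  have hlim : ∀ δ : ℝ, 0 < δ → ∫ ω, (dynkin lam X f T ω - dynkin lam X f 0 ω) ^ 2 ∂P ≤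
      2 * T * (γ + 2 * L * δ) := fun δ hδ => by
    have ht : Tendsto (fun n : ℕ => (T : ℝ) / ((n : ℝ) + 1)) atTop (𝓝 0) := by
      have := (tendsto_one_div_add_atTop_nhds_zero_nat (𝕜 := ℝ)).const_mul (T : ℝ)
      simpa [div_eq_mul_inv] using this
    refine ge_of_tendsto' (x := atTop) (f := fun n : ℕ => 2 * (T : ℝ) *
      (γ + 2 * L * (δ + C₁ * (T / (n + 1)) / δ)) + 2 * L ^ 2 * T * (T / (n + 1))) ?_ (hgrid δ hδ)
    have := ((((((ht.const_mul C₁).div_const δ).const_add δ).const_mul (2 * L)).const_add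
      γ).const_mul (2 * (T : ℝ))).add (ht.const_mul (2 * L ^ 2 * T))
    simpa using this
  refine ge_of_tendsto (x := 𝓝[>] (0 : ℝ)) (f := fun δ : ℝ => 2 * (T : ℝ) * (γ + 2 * L * δ)) ?_
    (eventually_mem_nhdsWithin.mono hlim)
  have hc : Continuous fun δ : ℝ => 2 * (T : ℝ) * (γ + 2 * L * δ) := by fun_prop
  have := (hc.tendsto 0).mono_left (nhdsWithin_le_nhds (s := Ioi 0))
  simpa using this

/-- The maximal inequality for the Dynkin martingales. -/
lemma measure_exists_lt_abs_dynkin_sub_le (h : IsUrnProcess lam N P X) (K : ℕ)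
    (g : Config N → ℝ) {γ : ℝ} (hγ : ∀ x, carreDuChamp lam N (truncate K g) x ≤ γ)
    {T : ℝ≥0} (hT : 0 < T) {ε : ℝ≥0} (hε : 0 < ε) :
    P {ω | ∃ t ≤ T, (ε : ℝ) < |dynkin lam X (truncate K g) t ω -
        dynkin lam X (truncate K g) 0 ω|} ≤
      ENNReal.ofReal (Real.sqrt (2 * T * γ)) / ε := by
  obtain ⟨L, hL0, hL⟩ := exists_abs_truncate_le K (generator lam N g)
  rw [← generator_truncate] at hL
  have hM := h.martingale _ (finite_support_truncate K g)
  refine (measure_exists_lt_abs_sub_le hM (h.rightContinuous_dynkin hL) hT hε).trans ?_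
  gcongr
  refine Real.le_sqrt_of_sq_le ?_
  refine le_trans ?_ (h.integral_sq_dynkin_sub_le K g hγ T)
  obtain ⟨B, hB0, hB⟩ := exists_abs_truncate_le K g
  have hMb : ∀ (t : ℝ≥0) ω, |dynkin lam X (truncate K g) t ω| ≤ B + L * t := fun t ω => by
    refine (abs_sub _ _).trans (add_le_add (hB _) ?_)
    have := abs_integral_le_of_abs_le X hL 0 t zero_le ω
    simpa using this
  have hi : Integrable (fun ω => dynkin lam X (truncate K g) T ω -
      dynkin lam X (truncate K g) 0 ω) P := (hM.integrable T).sub (hM.integrable 0)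
  have hmem : MemLp (fun ω => |dynkin lam X (truncate K g) T ω -
      dynkin lam X (truncate K g) 0 ω|) 2 P :=
    MemLp.of_bound hi.abs.aestronglyMeasurable ((B + L * T) + (B + L * (0 : ℝ≥0)))
      (ae_of_all _ fun ω => by
        rw [Real.norm_eq_abs, abs_abs]
        exact (abs_sub _ _).trans (add_le_add (hMb T ω) (hMb 0 ω)))
  have hv := variance_nonneg (fun ω => |dynkin lam X (truncate K g) T ω -
      dynkin lam X (truncate K g) 0 ω|) P
  rw [variance_eq_sub hmem] at hv
  simp only [Pi.pow_apply, sq_abs] at hv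
  exact sub_nonneg.1 hv

end IsUrnProcess

end Dynkin

/-! ### Poisson initial configurations -/

lemma hasSum_poisson_mul_id (r : ℝ≥0) :
    HasSum (fun n : ℕ => Real.exp (-r) * (r : ℝ) ^ n / (n.factorial : ℝ) * n) r := by
  have h := (hasSum_one_poissonMeasure r).mul_left (r : ℝ)
  rw [← hasSum_nat_add_iff' 1]
  simp only [Finset.range_one, Finset.sum_singleton, Nat.cast_zero, mul_zero, sub_zero]
  rw [mul_one] at h
  refine h.congr_fun fun n => ?_
  rw [Nat.factorial_succ]
  push_cast
  field_simp
  ring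

lemma hasSum_poisson_mul_sq (r : ℝ≥0) :
    HasSum (fun n : ℕ => Real.exp (-r) * (r : ℝ) ^ n / (n.factorial : ℝ) * (n : ℝ) ^ 2)
      (r + r ^ 2) := by
  have h := ((hasSum_poisson_mul_id r).add (hasSum_one_poissonMeasure r)).mul_left (r : ℝ)
  rw [← hasSum_nat_add_iff' 1]
  simp only [Finset.range_one, Finset.sum_singleton, Nat.cast_zero, mul_zero, sub_zero,
    zero_pow two_ne_zero]
  have e : (r : ℝ) * (r + 1) = r + r ^ 2 := by ring
  rw [e] at h
  refine h.congr_fun fun n => ?_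
  rw [Nat.factorial_succ]
  push_cast
  field_simp
  ring

section PoissonLaw

variable {Ω : Type*} [MeasurableSpace Ω] {P : Measure Ω} {Y : Ω → ℕ} {r : ℝ≥0}

lemma integrable_comp_of_hasLaw_poisson (h : HasLaw Y (poissonMeasure r) P) {g : ℕ → ℝ}
    (hg : ∀ n, 0 ≤ g n)
    (hs : Summable (fun n : ℕ => Real.exp (-r) * (r : ℝ) ^ n / (n.factorial : ℝ) * g n)) :
    Integrable (fun ω => g (Y ω)) P := by
  have h1 : Integrable g (poissonMeasure r) := by
    rw [integrable_poissonMeasure_iff]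
    simpa only [Real.norm_of_nonneg (hg _)] using hs
  rw [← h.map_eq] at h1
  exact (integrable_map_measure h1.aestronglyMeasurable h.aemeasurable).1 h1

lemma integral_comp_of_hasLaw_poisson (h : HasLaw Y (poissonMeasure r) P) {g : ℕ → ℝ} {a : ℝ}
    (hs : HasSum (fun n : ℕ => Real.exp (-r) * (r : ℝ) ^ n / (n.factorial : ℝ) * g n) a) :
    ∫ ω, g (Y ω) ∂P = a := by
  have h1 : ∫ n, g n ∂(P.map Y) = ∫ ω, g (Y ω) ∂P :=
    integral_map h.aemeasurable (measurable_of_countable g).aestronglyMeasurable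
  rw [← h1, h.map_eq, integral_poissonMeasure]
  exact hs.tsum_eq

lemma memLp_two_of_hasLaw_poisson (h : HasLaw Y (poissonMeasure r) P) :
    MemLp (fun ω => (Y ω : ℝ)) 2 P := by
  have hm : AEStronglyMeasurable (fun ω => (Y ω : ℝ)) P :=
    ((measurable_of_countable (Nat.cast : ℕ → ℝ)).comp_aemeasurable
      h.aemeasurable).aestronglyMeasurable
  rw [memLp_two_iff_integrable_sq hm]
  exact integrable_comp_of_hasLaw_poisson h (g := fun n => (n : ℝ) ^ 2) (fun n => sq_nonneg _)
    (hasSum_poisson_mul_sq r).summable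

lemma variance_of_hasLaw_poisson [IsProbabilityMeasure P] (h : HasLaw Y (poissonMeasure r) P) :
    variance (fun ω => (Y ω : ℝ)) P = r := by
  rw [variance_eq_sub (memLp_two_of_hasLaw_poisson h)]
  have h1 := integral_comp_of_hasLaw_poisson h (g := fun n => (n : ℝ)) (hasSum_poisson_mul_id r)
  have h2 := integral_comp_of_hasLaw_poisson h (g := fun n => (n : ℝ) ^ 2)
    (hasSum_poisson_mul_sq r)
  simp only [Pi.pow_apply]
  rw [h1, h2]
  ring

end PoissonLaw

/-- The law of large numbers for the initial empirical measures. -/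
lemma PoissonInitial.measure_le_abs_sub_le {Ω : Type*} [MeasurableSpace Ω] {P : Measure Ω}
    [IsProbabilityMeasure P] {X : ℝ≥0 → Ω → Config N} {φ : C(I, ℝ)} (hφ : ∀ x, 0 ≤ φ x)
    (hN : 0 < N) (h : PoissonInitial φ N P X) (g : C(I, ℝ)) {η : ℝ} (hη : 0 < η) :
    P {ω | η ≤ |empirical (X 0 ω) g - (1 / N : ℝ) * ∑ i : Fin N, g (loc i) * φ (loc i)|} ≤
      ENNReal.ofReal (‖φ‖ * ‖g‖ ^ 2 / N / η ^ 2) := by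
  have hN' : (0 : ℝ) < N := by exact_mod_cast hN
  set Y : Fin N → Ω → ℝ := fun i ω => (g (loc i) / N) * (X 0 ω i : ℝ) with hY
  have hYm : ∀ i, MemLp (Y i) 2 P := fun i =>
    (memLp_two_of_hasLaw_poisson (h.2 i)).const_mul _
  have hind : Pairwise fun i j => IndepFun (Y i) (Y j) P := fun i j hij =>
    (h.1.indepFun hij).comp (φ := fun n : ℕ => (g (loc i) / N) * (n : ℝ))
      (ψ := fun n : ℕ => (g (loc j) / N) * (n : ℝ)) (measurable_of_countable _)
      (measurable_of_countable _)
  have hvar : variance (∑ i, Y i) P ≤ ‖φ‖ * ‖g‖ ^ 2 / N := by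
    rw [IndepFun.variance_sum (fun i _ => hYm i) (fun i _ j _ hij => hind hij)]
    have hi : ∀ i ∈ Finset.univ, variance (Y i) P ≤ ‖φ‖ * ‖g‖ ^ 2 / N ^ 2 := fun i _ => by
      rw [hY, variance_const_mul, variance_of_hasLaw_poisson (h.2 i),
        Real.coe_toNNReal _ (hφ _), div_pow, div_mul_eq_mul_div, mul_comm]
      have h1 : φ (loc i) ≤ ‖φ‖ := (le_abs_self _).trans (abs_apply_le_norm φ _)
      have h2 : g (loc i) ^ 2 ≤ ‖g‖ ^ 2 := by
        rw [← sq_abs]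
        exact pow_le_pow_left₀ (abs_nonneg _) (abs_apply_le_norm g _) 2
      gcongr
    refine (Finset.sum_le_sum hi).trans (le_of_eq ?_)
    rw [Finset.sum_const, Finset.card_univ, Fintype.card_fin, nsmul_eq_mul]
    field_simp
  have hmean : ∫ ω, (∑ i, Y i) ω ∂P = (1 / N : ℝ) * ∑ i : Fin N, g (loc i) * φ (loc i) := by
    simp only [Finset.sum_apply]
    rw [integral_finsetSum _ fun i _ => (hYm i).integrable (by norm_num), Finset.mul_sum]
    refine Finset.sum_congr rfl fun i _ => ?_
    rw [hY, integral_const_mul, integral_comp_of_hasLaw_poisson (h.2 i) (g := fun n => (n : ℝ))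
      (hasSum_poisson_mul_id _), Real.coe_toNNReal _ (hφ _)]
    ring
  have hsum : ∀ ω, empirical (X 0 ω) g = (∑ i, Y i) ω := fun ω => by
    rw [empirical_apply, Finset.sum_apply, Finset.mul_sum]
    refine Finset.sum_congr rfl fun i _ => ?_
    rw [hY]
    ring
  have hL2 : MemLp (∑ i, Y i) 2 P := memLp_finsetSum' _ fun i _ => hYm i
  have := meas_ge_le_variance_div_sq hL2 hη
  rw [hmean] at this
  simp only [hsum]
  refine this.trans (ENNReal.ofReal_le_ofReal ?_)
  gcongr

/-! ### The empirical measures -/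

lemma abs_empirical_le (hN : 0 < N) {x : Config N} {C : ℝ} (hx : (total x : ℝ) ≤ C * N)
    (g : C(I, ℝ)) : |empirical x g| ≤ C * ‖g‖ := by
  have hN' : (0 : ℝ) < N := by exact_mod_cast hN
  rw [empirical_apply, abs_mul, abs_of_pos (by positivity)]
  have h1 : |∑ i, (x i : ℝ) * g (loc i)| ≤ total x * ‖g‖ := by
    refine (Finset.abs_sum_le_sum_abs _ _).trans ?_
    rw [total, Nat.cast_sum, Finset.sum_mul]
    refine Finset.sum_le_sum fun i _ => ?_
    rw [abs_mul, Nat.abs_cast]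
    gcongr
    exact abs_apply_le_norm g _
  calc (1 / N : ℝ) * |∑ i, (x i : ℝ) * g (loc i)| ≤ (1 / N : ℝ) * (C * N * ‖g‖) := by
        gcongr
        exact h1.trans (by gcongr)
    _ = C * ‖g‖ := by field_simp

lemma empirical_move_sub {x : Config N} {i : Fin N} (j : Fin N) (hi : x i ≠ 0) (g : C(I, ℝ)) :
    empirical (move x i j) g - empirical x g = (1 / N : ℝ) * (g (loc j) - g (loc i)) := by
  rw [empirical_apply, empirical_apply, sum_move_mul j hi fun l => g (loc l)]
  ring

lemma generator_empirical (lam : C(I × I, ℝ)) (g : C(I, ℝ)) (x : Config N) :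
    generator lam N (fun y => empirical y g) x = empirical x (discreteDrift lam N g) := by
  rw [empirical_apply, generator, Finset.mul_sum]
  refine Finset.sum_congr rfl fun i _ => ?_
  change _ = 1 / (N : ℝ) * ((x i : ℝ) *
    ((1 / N : ℝ) * ∑ j : Fin N, lam (loc i, loc j) * (g (loc j) - g (loc i))))
  simp only [Finset.mul_sum]
  refine Finset.sum_congr rfl fun j _ => ?_
  by_cases hi : x i = 0
  · simp [hi]
  · rw [empirical_move_sub j hi]
    ring

lemma carreDuChamp_truncate_empirical_le (lam : C(I × I, ℝ)) (hN : 0 < N) (g : C(I, ℝ)) {K : ℕ}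
    {C : ℝ} (hC : 0 ≤ C) (hK : (K : ℝ) ≤ C * N) (x : Config N) :
    carreDuChamp lam N (truncate K fun y => empirical y g) x ≤
      4 * C * ‖lam‖ * ‖g‖ ^ 2 / N := by
  have hN' : (0 : ℝ) < N := by exact_mod_cast hN
  rw [carreDuChamp_truncate]
  by_cases hx : total x ≤ K
  · rw [truncate_of_le _ hx, carreDuChamp]
    have hij : ∀ i j, (x i : ℝ) * lam (loc i, loc j) / N *
        (empirical (move x i j) g - empirical x g) ^ 2 ≤
        (x i : ℝ) * (4 * ‖lam‖ * ‖g‖ ^ 2 / N ^ 3) := by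
      intro i j
      by_cases hi : x i = 0
      · simp [hi]
      · rw [empirical_move_sub j hi]
        have h1 : (g (loc j) - g (loc i)) ^ 2 ≤ (2 * ‖g‖) ^ 2 := by
          rw [← sq_abs]
          refine pow_le_pow_left₀ (abs_nonneg _) ((abs_sub _ _).trans ?_) 2
          linarith [abs_apply_le_norm g (loc j), abs_apply_le_norm g (loc i)]
        have h2 : lam (loc i, loc j) ≤ ‖lam‖ := (le_abs_self _).trans (abs_apply_le_norm lam _)
        calc (x i : ℝ) * lam (loc i, loc j) / N * (1 / N * (g (loc j) - g (loc i))) ^ 2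
            = (x i : ℝ) * (lam (loc i, loc j) * (g (loc j) - g (loc i)) ^ 2 / N ^ 3) := by
              field_simp
          _ ≤ (x i : ℝ) * (‖lam‖ * (2 * ‖g‖) ^ 2 / N ^ 3) := by gcongr
          _ = _ := by ring
    calc _ ≤ ∑ i, ∑ _j : Fin N, (x i : ℝ) * (4 * ‖lam‖ * ‖g‖ ^ 2 / N ^ 3) :=
          Finset.sum_le_sum fun i _ => Finset.sum_le_sum fun j _ => hij i j
      _ = total x * (4 * ‖lam‖ * ‖g‖ ^ 2 / N ^ 2) := by
          simp only [Finset.sum_const, Finset.card_univ, Fintype.card_fin, nsmul_eq_mul]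
          rw [← Finset.mul_sum, ← Finset.sum_mul, total, Nat.cast_sum]
          field_simp
      _ ≤ C * N * (4 * ‖lam‖ * ‖g‖ ^ 2 / N ^ 2) := by
          gcongr
          exact le_trans (by exact_mod_cast hx) hK
      _ = _ := by field_simp
  · rw [truncate, if_neg hx]
    positivity

/-! ### Convergence of the empirical measures -/

variable {lam : C(I × I, ℝ)} {Ω : Type*} [MeasurableSpace Ω] {P : Measure Ω}
  {X : ℝ≥0 → Ω → Config N}

/-- The number of balls is conserved, up to an arbitrary time: the indicator function of the
configurations with at most `K` balls has carré du champ zero, so that its Dynkin martingale is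
constant. -/
lemma IsUrnProcess.measure_total_gt_eq_zero [IsProbabilityMeasure P]
    (h : IsUrnProcess lam N P X) (K : ℕ) {T : ℝ≥0} (hT : 0 < T) :
    P {ω | total (X 0 ω) ≤ K ∧ ∃ t ≤ T, K < total (X t ω)} = 0 := by
  have hgen : generator lam N (fun _ : Config N => (1 : ℝ)) = 0 := by
    ext x; simp [generator]
  have hcdc : ∀ x : Config N, carreDuChamp lam N (truncate K fun _ => 1) x ≤ 0 := fun x => by
    rw [carreDuChamp_truncate]
    simp [truncate, carreDuChamp]
  have h1 := h.measure_exists_lt_abs_dynkin_sub_le K (fun _ => 1) hcdc hT (ε := 1 / 2)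
    (by positivity)
  rw [mul_zero, Real.sqrt_zero, ENNReal.ofReal_zero, ENNReal.zero_div] at h1
  refine measure_mono_null (fun ω hω => ?_) (le_antisymm h1 zero_le)
  obtain ⟨h0, t, ht, hKt⟩ := hω
  refine ⟨t, ht, ?_⟩
  have hz : ∀ x : Config N, generator lam N (truncate K fun _ => 1) x = 0 := fun x => by
    rw [generator_truncate, hgen]
    simp [truncate]
  simp only [dynkin, hz, intervalIntegral.integral_zero, sub_zero]
  rw [truncate_of_le _ h0, truncate, if_neg (not_le.2 hKt)]
  norm_num

/-- A path of the urn model whose martingale parts and initial value are close to their limits,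
for the first iterates `g_k` of the drift, stays close to the solution of the limit equation. -/
lemma IsUrnProcess.abs_empirical_sub_pairing_le (h : IsUrnProcess lam N P X) (hN : 0 < N)
    (φ : C(I, ℝ)) {T C R ε : ℝ} (hC : 0 ≤ C) (hR : 0 ≤ R) (hε : 0 ≤ ε)
    (hdens : ∀ t ∈ Icc 0 T, ∀ g, |pairing (density lam φ t) g| ≤ R * ‖g‖)
    (f : C(I, ℝ)) (n K : ℕ) (hK : (K : ℝ) ≤ C * N) (ω : Ω)
    (hmass : ∀ t ∈ Icc 0 T, total (X t.toNNReal ω) ≤ K)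
    (hmart : ∀ k < n, ∀ t ∈ Icc 0 T,
      |dynkin lam X (truncate K fun y => empirical y ((drift lam)^[k] f)) t.toNNReal ω -
        dynkin lam X (truncate K fun y => empirical y ((drift lam)^[k] f)) 0 ω| ≤ ε)
    (hinit : ∀ k < n, |empirical (X 0 ω) ((drift lam)^[k] f) -
      pairing φ ((drift lam)^[k] f)| ≤ 2 * ε)
    (hdrift : ∀ k < n, T * (C * ‖discreteDrift lam N ((drift lam)^[k] f) -
      drift lam ((drift lam)^[k] f)‖) ≤ ε) :
    ∀ t ∈ Icc 0 T, |empirical (X t.toNNReal ω) f - pairing (density lam φ t) f| ≤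
      (2 * (4 * ε) + (C + R) * ‖f‖ * (1 / 2) ^ n) * Real.exp (2 * (2 * ‖lam‖ + 1) * T) := by
  have hmass' : ∀ t ∈ Icc 0 T, (total (X t.toNNReal ω) : ℝ) ≤ C * N := fun t ht =>
    le_trans (by exact_mod_cast hmass t ht) hK
  refine abs_le_of_approx_solution lam (by positivity) (by positivity)
    (fun t g => empirical (X t.toNNReal ω) g - pairing (density lam φ t) g) f n
    (fun t ht g => ?_) (fun k hk t ht => ?_)
  · refine (abs_sub _ _).trans ?_
    rw [add_mul]
    exact add_le_add (abs_empirical_le hN (hmass' t ht) g) (hdens t ht g)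
  set g := (drift lam)^[k] f with hg
  have hsub : ∀ s ∈ Icc 0 t, s ∈ Icc 0 T := fun s hs => ⟨hs.1, hs.2.trans ht.2⟩
  obtain ⟨L, hL0, hL⟩ := exists_abs_truncate_le K (generator lam N fun y => empirical y g)
  rw [← generator_truncate] at hL
  have e1 := h.dynkin_sub hL 0 t.toNNReal ω
  rw [truncate_of_le _ (hmass t ht), truncate_of_le _ (by simpa using hmass 0 ⟨le_rfl,
    ht.1.trans ht.2⟩), Real.coe_toNNReal t ht.1, NNReal.coe_zero] at e1
  -- on the path, the truncated generator acts as the discretized drift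
  have e2 : ∫ u in (0 : ℝ)..t, generator lam N (truncate K fun y => empirical y g)
      (X u.toNNReal ω) = ∫ u in (0 : ℝ)..t, empirical (X u.toNNReal ω) (discreteDrift lam N g) := by
    refine intervalIntegral.integral_congr fun u hu => ?_
    rw [uIcc_of_le ht.1] at hu
    rw [generator_truncate, truncate_of_le _ (hmass u (hsub u hu)), generator_empirical]
  have hint : ∀ g' : C(I, ℝ), IntervalIntegrable (fun u : ℝ => empirical (X u.toNNReal ω) g')
      volume 0 t := fun g' => by
    have hm := measurable_of_rightContinuous (h.rightContinuous (fun x => empirical x g') ω)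
    refine (intervalIntegrable_const (c := C * ‖g'‖)).mono_fun hm.aestronglyMeasurable ?_
    refine (ae_restrict_iff' measurableSet_uIoc).2 (ae_of_all _ fun u hu => ?_)
    rw [uIoc_of_le ht.1] at hu
    exact (abs_empirical_le hN (hmass' u (hsub u ⟨hu.1.le, hu.2⟩)) g').trans (le_abs_self _)
  have hint2 : IntervalIntegrable (fun u : ℝ => pairing (density lam φ u) (drift lam g))
      volume 0 t := by
    refine Continuous.intervalIntegrable ?_ _ _
    simp only [pairing_comm _ (drift lam g)]
    exact (pairing _).continuous.comp (continuous_density lam φ)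
  have e3 : |(∫ u in (0 : ℝ)..t, empirical (X u.toNNReal ω) (discreteDrift lam N g)) -
      ∫ u in (0 : ℝ)..t, empirical (X u.toNNReal ω) (drift lam g)| ≤ ε := by
    rw [← intervalIntegral.integral_sub (hint _) (hint _)]
    have h1 := intervalIntegral.norm_integral_le_of_norm_le_const (a := (0 : ℝ)) (b := t)
      (f := fun u => empirical (X u.toNNReal ω) (discreteDrift lam N g) -
        empirical (X u.toNNReal ω) (drift lam g))
      (C := C * ‖discreteDrift lam N g - drift lam g‖) (fun u hu => by
        rw [uIoc_of_le ht.1] at hu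
        rw [← map_sub]
        exact abs_empirical_le hN (hmass' u (hsub u ⟨hu.1.le, hu.2⟩)) _)
    rw [sub_zero, abs_of_nonneg ht.1] at h1
    refine h1.trans (le_trans ?_ (hdrift k hk))
    rw [mul_comm]
    gcongr
    exact ht.2
  have e4 := pairing_density_eq lam φ t g
  have e5 := hmart k hk t ht
  have e6 := hinit k hk
  rw [e1, e2] at e5
  rw [intervalIntegral.integral_sub (hint _) hint2, e4]
  rw [abs_le] at *
  constructor <;> linarith [e3.1, e3.2, e5.1, e5.2, e6.1, e6.2]

lemma total_le_of_abs_empirical_sub_lt (hN : 0 < N) (φ : C(I, ℝ)) (x : Config N)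
    (h : |empirical x 1 - (1 / N : ℝ) * ∑ i : Fin N, (1 : C(I, ℝ)) (loc i) * φ (loc i)| < 1) :
    total x ≤ ⌊(‖φ‖ + 1) * (N : ℝ)⌋₊ := by
  have hN' : (0 : ℝ) < N := by exact_mod_cast hN
  have h1 : empirical x 1 = total x / N := by
    rw [empirical_apply, total, Nat.cast_sum, one_div, ← div_eq_inv_mul]
    simp
  have h2 : (1 / N : ℝ) * ∑ i : Fin N, (1 : C(I, ℝ)) (loc i) * φ (loc i) ≤ ‖φ‖ := by
    have : ∑ i : Fin N, (1 : C(I, ℝ)) (loc i) * φ (loc i) ≤ ∑ _i : Fin N, ‖φ‖ :=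
      Finset.sum_le_sum fun i _ => by
        simpa using (le_abs_self _).trans (abs_apply_le_norm φ (loc i))
    rw [Finset.sum_const, Finset.card_univ, Fintype.card_fin, nsmul_eq_mul] at this
    rw [one_div, ← div_eq_inv_mul, div_le_iff₀ hN']
    linarith
  refine Nat.le_floor ?_
  rw [h1] at h
  have h3 := (abs_lt.1 h).2
  have h4 : (total x : ℝ) / N ≤ ‖φ‖ + 1 := by linarith
  rwa [div_le_iff₀ hN'] at h4

/-- The probability that the path of empirical measures, tested against `f`, leaves the
neighbourhood of the solution of the limit equation. The four terms are the probabilities of an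
excess of balls (more than `‖φ‖ + 1` per box), of a failure of the conservation of balls, of large
martingale parts and of an atypical initial value. -/
lemma IsUrnProcess.measure_not_forall_le [IsProbabilityMeasure P] (h : IsUrnProcess lam N P X)
    {φ : C(I, ℝ)} (hφ : ∀ x, 0 ≤ φ x) (h0 : PoissonInitial φ N P X) (hN : 0 < N)
    {T : ℝ} (hT : 0 < T) {R : ℝ} (hR : 0 ≤ R)
    (hdens : ∀ t ∈ Icc 0 T, ∀ g, |pairing (density lam φ t) g| ≤ R * ‖g‖)
    (f : C(I, ℝ)) (n : ℕ) {ε : ℝ≥0} (hε : 0 < ε)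
    (hriem : ∀ k < n, |(1 / N : ℝ) * ∑ i : Fin N, ((drift lam)^[k] f) (loc i) * φ (loc i) -
      pairing φ ((drift lam)^[k] f)| ≤ ε)
    (hdrift : ∀ k < n, T * ((‖φ‖ + 1) * ‖discreteDrift lam N ((drift lam)^[k] f) -
      drift lam ((drift lam)^[k] f)‖) ≤ ε) :
    P {ω | ¬ ∀ t ∈ Icc 0 T, |empirical (X t.toNNReal ω) f - pairing (density lam φ t) f| ≤
      (2 * (4 * ε) + ((‖φ‖ + 1) + R) * ‖f‖ * (1 / 2) ^ n) *
        Real.exp (2 * (2 * ‖lam‖ + 1) * T)} ≤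
      (ENNReal.ofReal (‖φ‖ * ‖(1 : C(I, ℝ))‖ ^ 2 / N / 1 ^ 2) + 0) +
      ((∑ k ∈ Finset.range n, ENNReal.ofReal (Real.sqrt (2 * T *
        (4 * (‖φ‖ + 1) * ‖lam‖ * ‖(drift lam)^[k] f‖ ^ 2 / N))) / ε) +
      ∑ k ∈ Finset.range n, ENNReal.ofReal
        (‖φ‖ * ‖(drift lam)^[k] f‖ ^ 2 / N / (ε : ℝ) ^ 2)) := by
  set K : ℕ := ⌊(‖φ‖ + 1) * (N : ℝ)⌋₊ with hKdef
  have hK : (K : ℝ) ≤ (‖φ‖ + 1) * N := Nat.floor_le (by positivity)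
  have hT' : (0 : ℝ≥0) < T.toNNReal := Real.toNNReal_pos.2 hT
  set g : ℕ → C(I, ℝ) := fun k => (drift lam)^[k] f with hg
  set A : Set Ω := {ω | 1 ≤ |empirical (X 0 ω) 1 -
    (1 / N : ℝ) * ∑ i : Fin N, (1 : C(I, ℝ)) (loc i) * φ (loc i)|} with hA
  set A' : Set Ω := {ω | total (X 0 ω) ≤ K ∧ ∃ t ≤ T.toNNReal, K < total (X t ω)} with hA'
  set B : ℕ → Set Ω := fun k => {ω | ∃ t ≤ T.toNNReal,
    (ε : ℝ) < |dynkin lam X (truncate K fun y => empirical y (g k)) t ω -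
      dynkin lam X (truncate K fun y => empirical y (g k)) 0 ω|} with hB
  set D : ℕ → Set Ω := fun k => {ω | (ε : ℝ) ≤ |empirical (X 0 ω) (g k) -
    (1 / N : ℝ) * ∑ i : Fin N, (g k) (loc i) * φ (loc i)|} with hD
  have hcov : {ω | ¬ ∀ t ∈ Icc 0 T, |empirical (X t.toNNReal ω) f - pairing (density lam φ t) f| ≤
      (2 * (4 * ε) + ((‖φ‖ + 1) + R) * ‖f‖ * (1 / 2) ^ n) *
        Real.exp (2 * (2 * ‖lam‖ + 1) * T)} ⊆
      (A ∪ A') ∪ ((⋃ k ∈ Finset.range n, B k) ∪ ⋃ k ∈ Finset.range n, D k) := by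
    intro ω hω
    by_contra hcon
    refine hω ?_
    simp only [mem_union, mem_iUnion, Finset.mem_range, not_or, not_exists] at hcon
    obtain ⟨⟨hωA, hωA'⟩, hωB, hωD⟩ := hcon
    have ht0 := total_le_of_abs_empirical_sub_lt hN φ (X 0 ω) (not_le.1 fun hle => hωA hle)
    refine h.abs_empirical_sub_pairing_le hN φ (by positivity) hR ε.2 hdens f n K hK ω
      (fun t ht => ?_) (fun k hk t ht => ?_) (fun k hk => ?_) hdrift
    · by_contra hcon
      exact hωA' ⟨ht0, t.toNNReal, Real.toNNReal_mono ht.2, not_le.1 hcon⟩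
    · by_contra hcon
      exact hωB k hk ⟨t.toNNReal, Real.toNNReal_mono ht.2, not_le.1 hcon⟩
    · have h1 : |empirical (X 0 ω) (g k) -
          (1 / N : ℝ) * ∑ i : Fin N, (g k) (loc i) * φ (loc i)| ≤ ε :=
        le_of_not_ge fun hle => hωD k hk hle
      have h2 := hriem k hk
      change |empirical (X 0 ω) (g k) - pairing φ (g k)| ≤ 2 * ε
      calc |empirical (X 0 ω) (g k) - pairing φ (g k)| ≤
            |empirical (X 0 ω) (g k) - (1 / N : ℝ) * ∑ i : Fin N, (g k) (loc i) * φ (loc i)| +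
            |(1 / N : ℝ) * ∑ i : Fin N, (g k) (loc i) * φ (loc i) - pairing φ (g k)| :=
          abs_sub_le _ _ _
        _ ≤ 2 * ε := by rw [two_mul]; exact add_le_add h1 h2
  refine (measure_mono hcov).trans ((measure_union_le _ _).trans (add_le_add
    ((measure_union_le _ _).trans (add_le_add ?_ ?_))
    ((measure_union_le _ _).trans (add_le_add ?_ ?_))))
  · exact h0.measure_le_abs_sub_le hφ hN 1 one_pos
  · exact (h.measure_total_gt_eq_zero K hT').le
  · refine (measure_biUnion_finset_le _ _).trans (Finset.sum_le_sum fun k _ => ?_)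
    have := h.measure_exists_lt_abs_dynkin_sub_le K (fun y => empirical y (g k))
      (carreDuChamp_truncate_empirical_le lam hN (g k) (by positivity) hK) hT' hε
    rwa [Real.coe_toNNReal T hT.le] at this
  · refine (measure_biUnion_finset_le _ _).trans (Finset.sum_le_sum fun k _ => ?_)
    exact h0.measure_le_abs_sub_le hφ hN (g k) (NNReal.coe_pos.2 hε)

lemma tendsto_ofReal_div_natCast (a b : ℝ) :
    Tendsto (fun N : ℕ => ENNReal.ofReal (a / N / b)) atTop (𝓝 0) := by
  have h := (tendsto_const_div_atTop_nhds_zero_nat a).div_const b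
  rw [zero_div] at h
  simpa using ENNReal.tendsto_ofReal h

lemma tendsto_ofReal_sqrt_div_natCast (a b : ℝ) {c : ℝ≥0} (hc : 0 < c) :
    Tendsto (fun N : ℕ => ENNReal.ofReal (Real.sqrt (a * (b / N))) / (c : ENNReal)) atTop
      (𝓝 0) := by
  have h := ((tendsto_const_div_atTop_nhds_zero_nat b).const_mul a).sqrt
  rw [mul_zero, Real.sqrt_zero] at h
  have h2 := ENNReal.Tendsto.div_const (ENNReal.tendsto_ofReal h) (b := (c : ENNReal))
    (Or.inr (by simpa using hc.ne'))
  simpa using h2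

lemma IsUrnProcess.measurable_empiricalPath (h : IsUrnProcess lam N P X) {T : ℝ} (hT : 0 < T) :
    Measurable fun ω => empiricalPath T (fun t => X t ω) (h.cadlag ω) :=
  SkorokhodSpace.measurable_of_step hT
    (x := fun ω (t : Icc (0 : ℝ) T) => X ⟨t, t.2.1⟩ ω)
    (fun ω => (h.cadlag ω).comp_strictMono
      (e := fun t : Icc (0 : ℝ) T => (⟨t, t.2.1⟩ : ℝ≥0)) (by fun_prop) fun _ _ hst => hst)
    (fun t => h.measurable _) empirical _ fun _ _ => rfl

lemma tendstoInDistribution_empiricalPath {T : ℝ} (hT : 0 < T) (lam : C(I × I, ℝ))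
    {φ : C(I, ℝ)} (hφ : ∀ x, 0 ≤ φ x) (Ω : ℕ+ → Type*) [∀ N, MeasurableSpace (Ω N)]
    (P : ∀ N, Measure (Ω N)) [∀ N, IsProbabilityMeasure (P N)]
    (X : ∀ N : ℕ+, ℝ≥0 → Ω N → Config N)
    (hX : ∀ N : ℕ+, IsUrnProcess lam N (P N) (X N))
    (h0 : ∀ N : ℕ+, PoissonInitial φ N (P N) (X N)) :
    TendstoInDistribution
      (fun N ω => empiricalPath T (fun t => X N t ω) ((hX N).cadlag ω))
      atTop (fun _ : Unit => limitPath lam φ T) P (Measure.dirac ()) := by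
  refine SkorokhodSpace.tendstoInDistribution_of_uniform P _
    (fun N => (hX N).measurable_empiricalPath hT) _ fun f η hη => ?_
  obtain ⟨R, hR, hRb⟩ := (limitPath lam φ T).exists_abs_apply_le
  have hdens : ∀ t ∈ Icc 0 T, ∀ g, |pairing (density lam φ t) g| ≤ R * ‖g‖ :=
    fun t ht g => hRb ⟨t, ht⟩ g
  set E := Real.exp (2 * (2 * ‖lam‖ + 1) * T) with hE
  have hE0 : 0 < E := Real.exp_pos _
  obtain ⟨n, hn⟩ := ((tendsto_stability_bound (((‖φ‖ + 1) + R) * ‖f‖) E).eventually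
    (gt_mem_nhds (half_pos hη))).exists
  -- `n` makes the remainder of the iteration small, `ε` then bounds the errors of the `n` steps
  obtain ⟨ε, hε, hεE⟩ : ∃ ε : ℝ≥0, 0 < ε ∧ 2 * (4 * (ε : ℝ)) * E < η / 2 := by
    have hpos : 0 < η / (32 * E) := by positivity
    refine ⟨(η / (32 * E)).toNNReal, Real.toNNReal_pos.2 hpos, ?_⟩
    rw [Real.coe_toNNReal _ hpos.le]
    have : 2 * (4 * (η / (32 * E))) * E = η / 4 := by field_simp; norm_num
    rw [this]
    linarith
  have hsmall : (2 * (4 * (ε : ℝ)) + ((‖φ‖ + 1) + R) * ‖f‖ * (1 / 2) ^ n) * E < η := by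
    rw [add_mul]
    linarith
  have hriem : ∀ᶠ N : ℕ in atTop, ∀ k < n,
      |(1 / N : ℝ) * ∑ i : Fin N, ((drift lam)^[k] f) (loc i) * φ (loc i) -
        pairing φ ((drift lam)^[k] f)| ≤ ε := by
    simp only [← Finset.mem_range (n := n)]
    refine (eventually_all_finset (Finset.range n)).2 fun k _ => ?_
    have h1 := tendsto_riemannSum (g := fun x => ((drift lam)^[k] f) x * φ x) (by fun_prop)
    have h2 := (tendsto_iff_norm_sub_tendsto_zero.1 h1).eventually (gt_mem_nhds
      (NNReal.coe_pos.2 hε))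
    exact h2.mono fun N hN => hN.le
  have hdrift : ∀ᶠ N : ℕ in atTop, ∀ k < n,
      T * ((‖φ‖ + 1) * ‖discreteDrift lam N ((drift lam)^[k] f) -
        drift lam ((drift lam)^[k] f)‖) ≤ ε := by
    simp only [← Finset.mem_range (n := n)]
    refine (eventually_all_finset (Finset.range n)).2 fun k _ => ?_
    have hpos : 0 < (ε : ℝ) / (T * (‖φ‖ + 1)) := by positivity
    filter_upwards [eventually_norm_discreteDrift_sub_le lam ((drift lam)^[k] f) hpos] with N hN
    rw [le_div_iff₀ (by positivity)] at hN
    linarith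
  have hcoe : Tendsto (fun N : ℕ+ => (N : ℕ)) atTop atTop := tendsto_PNat_val_atTop_atTop
  have hlim : Tendsto (fun N : ℕ =>
      (ENNReal.ofReal (‖φ‖ * ‖(1 : C(I, ℝ))‖ ^ 2 / N / 1 ^ 2) + 0) +
      ((∑ k ∈ Finset.range n, ENNReal.ofReal (Real.sqrt (2 * T *
        (4 * (‖φ‖ + 1) * ‖lam‖ * ‖(drift lam)^[k] f‖ ^ 2 / N))) / (ε : ENNReal)) +
      ∑ k ∈ Finset.range n, ENNReal.ofReal
        (‖φ‖ * ‖(drift lam)^[k] f‖ ^ 2 / N / (ε : ℝ) ^ 2))) atTop (𝓝 0) := by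
    have h1 := (tendsto_ofReal_div_natCast (‖φ‖ * ‖(1 : C(I, ℝ))‖ ^ 2) (1 ^ 2)).add
      (tendsto_const_nhds (x := (0 : ENNReal)))
    have h2 := tendsto_finsetSum (a := fun _ => (0 : ENNReal)) (Finset.range n) fun k _ =>
      tendsto_ofReal_sqrt_div_natCast (2 * T)
        (4 * (‖φ‖ + 1) * ‖lam‖ * ‖(drift lam)^[k] f‖ ^ 2) hε
    have h3 := tendsto_finsetSum (a := fun _ => (0 : ENNReal)) (Finset.range n) fun k _ =>
      tendsto_ofReal_div_natCast (‖φ‖ * ‖(drift lam)^[k] f‖ ^ 2) ((ε : ℝ) ^ 2)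
    have h4 := h1.add (h2.add h3)
    simp only [Finset.sum_const_zero, add_zero] at h4
    simpa only [add_zero] using h4
  refine tendsto_of_tendsto_of_tendsto_of_le_of_le' tendsto_const_nhds (hlim.comp hcoe)
    (Eventually.of_forall fun N => zero_le) ?_
  filter_upwards [hcoe.eventually hriem, hcoe.eventually hdrift] with N hN1 hN2
  refine le_trans (measure_mono ?_)
    ((hX N).measure_not_forall_le hφ (h0 N) N.pos hT hR hdens f n hε hN1 hN2)
  intro ω hω hall
  refine hω fun t => ?_
  have h1 := (hall t t.2).trans_lt hsmall
  rwa [Real.toNNReal_of_nonneg t.2.1] at h1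

end Ehrenfest

theorem theorem2p1
    (T : ℝ) (hT : 0 < T)
    (lam : C(unitInterval × unitInterval, ℝ)) (hlam : Ehrenfest.IsC1 lam) (hpos : ∀ p, 0 ≤ lam p)
    (φ : C(unitInterval, ℝ)) (hφ : ∀ x, 0 ≤ φ x) :
    ∃ μ : Ehrenfest.SkorokhodSpace T,
      -- `μ` is the unique weak solution
      (Ehrenfest.IsWeakSolution lam φ hT μ ∧
        ∀ ν : Ehrenfest.SkorokhodSpace T, Ehrenfest.IsWeakSolution lam φ hT ν → ν = μ) ∧
      -- it has a density that solves the integral equation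
      (∃ ρ : ℝ → unitInterval → ℝ, Ehrenfest.SolvesDensityEquation lam φ T ρ ∧
        ∀ (t : Set.Icc (0 : ℝ) T) (f : C(unitInterval, ℝ)),
          μ t f = ∫ x : unitInterval, f x * ρ t x) ∧
      -- the empirical measure processes converge weakly to it
      (∀ (Ω : ℕ+ → Type*) (_ : ∀ N, MeasurableSpace (Ω N)) (P : ∀ N, Measure (Ω N))
        (_ : ∀ N, IsProbabilityMeasure (P N))
        (X : ∀ N : ℕ+, ℝ≥0 → Ω N → Ehrenfest.Config N)
        (hX : ∀ N : ℕ+, Ehrenfest.IsUrnProcess lam N (P N) (X N)),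
        (∀ N : ℕ+, Ehrenfest.PoissonInitial φ N (P N) (X N)) →
        TendstoInDistribution
          (fun N ω => Ehrenfest.empiricalPath T (fun t => X N t ω) ((hX N).cadlag ω))
          atTop (fun _ : Unit => μ) P (Measure.dirac ())) := by
  refine ⟨Ehrenfest.limitPath lam φ T, ⟨Ehrenfest.isWeakSolution_limitPath lam φ hT,
    fun ν hν => (Ehrenfest.isWeakSolution_limitPath lam φ hT).unique hν⟩,
    ⟨fun t x => Ehrenfest.density lam φ t x, Ehrenfest.solvesDensityEquation_density lam φ T,
      fun t f => rfl⟩, ?_⟩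
  intro Ω _ P _ X hX h0
  exact Ehrenfest.tendstoInDistribution_empiricalPath hT lam hφ Ω P X hX h0
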